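/- Let $d\ge 1$ and let $\sigma\in\mathbb R$. There is a constant $C>0$, depending only on $d$ and $\sigma$, with the following property. Let $K\subset\mathbb R^d$ be a nondegenerate closed $d$-simplex with vertices $x_1,\dots,x_{d+1}$, let $x_0$ be an interior point of $K$, and let $K^r=\{K_1,\dots,K_{d+1}\}$, where $K_i$ is the simplex with vertices $\{x_0,x_1,\dots,x_{d+1}\}\setminus\{x_i\}$. Suppose that the shape regularity constant $\max_{1\le i\le d+1} h_{K_i}/\rho_{K_i}$ of $K^r$ is at most $\sigma$, where $h_T$ is the diameter of $T$ and $\rho_T$ is the diameter of the largest ball contained in $T$. Let $\mu_1,\dots,\mu_{d+1}$ be the barycentric coordinates of $K$ (so $\mu_i(x_j)=\delta_{ij}$), let $\mathbf n_i$ be the unit normal, pointing out of $K$, to the face of $K$ opposite to $x_i$, and let $$\mathbf b_i=B_i\,\mathbf n_i,\qquad B_i=\prod_{\substack{1\le j\le d+1\\ j\ne i}}\mu_j$$ be the Bernardi–Raugel face bubbles. Then for every $i\in\{1,\dots,d+1\}$ there is a continuous vector field $\boldsymbol\beta_i:K\to\mathbb R^d$ in $[H^1(K)]^d$, each component of which is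 a polynomial of degree at most $d$ on each of $K_1,\dots,K_{d+1}$, such that $$\boldsymbol\beta_i|_{\partial K}=\mathbf b_i|_{\partial K},\qquad \operatorname{div}\boldsymbol\beta_i\ \text{is constant (a.e.) on } K,\qquad \|\boldsymbol\beta_i\|_{H^1(K)}\le C\,\|\mathbf b_i\|_{H^1(K)}.$$ Here derivatives are weak derivatives and $\|\mathbf v\|_{H^1(K)}^2=\int_K|\mathbf v|^2+\int_K|\nabla\mathbf v|^2$. -/

import Mathlib

open Set MeasureTheory
open scoped ContDiff

namespace MacroBubble

noncomputable section

/-- Euclidean space `ℝ^d`. -/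
abbrev E (d : ℕ) : Type := EuclideanSpace ℝ (Fin d)

/-! ### Weak derivatives and `H¹` -/

/-- `g` is a weak `j`-th partial derivative of `f` on the open set `U`. -/
def HasWeakPartial {d : ℕ} (U : Set (E d)) (j : Fin d) (f g : E d → ℝ) : Prop :=
  LocallyIntegrableOn f U volume ∧ LocallyIntegrableOn g U volume ∧
    ∀ φ : E d → ℝ, ContDiff ℝ ∞ φ → HasCompactSupport φ → tsupport φ ⊆ U →
      ∫ x in U, f x * fderiv ℝ φ x (EuclideanSpace.single j 1) = -∫ x in U, g x * φ x

open scoped Classical in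
/-- The weak `j`-th partial derivative of `f` on `U` (determined up to a null subset of `U`
whenever it exists; `0` if there is none). -/
def weakPartial {d : ℕ} (U : Set (E d)) (j : Fin d) (f : E d → ℝ) : E d → ℝ :=
  if h : ∃ g, HasWeakPartial U j f g then h.choose else 0

/-- `f ∈ H¹(U)`: `f` is in `L²(U)` and has all weak first partial derivatives in `L²(U)`. -/
def MemH1 {d : ℕ} (U : Set (E d)) (f : E d → ℝ) : Prop :=
  MemLp f 2 (volume.restrict U) ∧
    ∀ j, ∃ g, HasWeakPartial U j f g ∧ MemLp g 2 (volume.restrict U)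

/-- The full `H¹(U)` norm of a vector field,
`(∑ᵢ ∫ vᵢ² + ∑ᵢⱼ ∫ (∂ⱼ vᵢ)²)^(1/2)`, with weak derivatives. -/
def h1Norm {d : ℕ} (U : Set (E d)) (v : E d → E d) : ℝ :=
  Real.sqrt ((∑ i, ∫ x in U, (v x i) ^ 2) +
    ∑ i, ∑ j, ∫ x in U, (weakPartial U j (fun y => v y i) x) ^ 2)

/-- The weak divergence `∑ᵢ ∂ᵢ vᵢ` on `U`. -/
def weakDiv {d : ℕ} (U : Set (E d)) (v : E d → E d) (x : E d) : ℝ :=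
  ∑ i, weakPartial U i (fun y => v y i) x

/-! ### The macro simplex and its refinement

A nondegenerate `d`-simplex in `ℝ^d` is given by its `d + 1` affinely independent vertices,
that is, by an affine basis. -/

/-- The closed simplex `K`. -/
def simplex {d : ℕ} (K : AffineBasis (Fin (d + 1)) ℝ (E d)) : Set (E d) :=
  convexHull ℝ (range K)

/-- The cell `Kᵢ` of the refinement: its vertices are `x₀` and all vertices of `K` but the
`i`-th. -/
def cell {d : ℕ} (K : AffineBasis (Fin (d + 1)) ℝ (E d)) (x₀ : E d) (i : Fin (d + 1)) :
    Set (E d) :=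
  convexHull ℝ (insert x₀ (K '' {i}ᶜ))

/-- The diameter of the largest ball contained in `T`. -/
def inscribedDiam {d : ℕ} (T : Set (E d)) : ℝ :=
  sSup {ρ | ∃ (c : E d) (r : ℝ), 0 ≤ r ∧ Metric.closedBall c r ⊆ T ∧ ρ = 2 * r}

/-- The shape regularity constant of `T`: diameter over inscribed diameter. -/
def shapeConst {d : ℕ} (T : Set (E d)) : ℝ :=
  Metric.diam T / inscribedDiam T

/-- The shape regularity constant of the refinement: the maximum over its cells. -/
def refinementShapeConst {d : ℕ} (K : AffineBasis (Fin (d + 1)) ℝ (E d)) (x₀ : E d) : ℝ :=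
  Finset.univ.sup' Finset.univ_nonempty fun i => shapeConst (cell K x₀ i)

/-! ### Continuous piecewise polynomials -/

/-- `f` restricted to `T` is a polynomial of total degree at most `k`. -/
def IsPolyOn {d : ℕ} (k : ℕ) (T : Set (E d)) (f : E d → ℝ) : Prop :=
  ∃ p : MvPolynomial (Fin d) ℝ, p.totalDegree ≤ k ∧
    ∀ x ∈ T, f x = MvPolynomial.eval (fun j => x j) p

/-- The vector fields on `K` whose components are piecewise polynomials of degree at most `k` on
the refinement and lie in `H¹(K)`. Functions are taken in their continuous representative, so that
the trace on the boundary is the pointwise restriction. -/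
structure MemPc {d : ℕ} (k : ℕ) (K : AffineBasis (Fin (d + 1)) ℝ (E d)) (x₀ : E d)
    (v : E d → E d) : Prop where
  continuousOn : ContinuousOn v (simplex K)
  isPolyOn : ∀ (i : Fin (d + 1)) (m : Fin d), IsPolyOn k (cell K x₀ i) fun x => v x m
  memH1 : ∀ m : Fin d, MemH1 (interior (simplex K)) fun x => v x m

/-! ### Bernardi–Raugel face bubbles -/

/-- `n` is the unit normal, pointing out of `K`, to the face `Fᵢ` spanned by all vertices but the
`i`-th. -/
structure IsOutwardUnitNormal {d : ℕ} (K : AffineBasis (Fin (d + 1)) ℝ (E d)) (i : Fin (d + 1))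
    (n : E d) : Prop where
  norm_eq_one : ‖n‖ = 1
  normal : ∀ j k, j ≠ i → k ≠ i → inner ℝ n (K j - K k) = 0
  outward : ∀ j, j ≠ i → inner ℝ n (K i - K j) < 0

/-- The scalar face bubble: the product of the barycentric coordinates of all vertices but the
`i`-th. -/
def scalarBubble {d : ℕ} (K : AffineBasis (Fin (d + 1)) ℝ (E d)) (i : Fin (d + 1)) (x : E d) : ℝ :=
  ∏ j ∈ Finset.univ.erase i, K.coord j x

/-- The face bubble with normal `n`. -/
def faceBubble {d : ℕ} (K : AffineBasis (Fin (d + 1)) ℝ (E d)) (i : Fin (d + 1)) (n : E d)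
    (x : E d) : E d :=
  scalarBubble K i x • n

/-- Every face has an outward unit normal, and only one. -/
theorem existsUnique_isOutwardUnitNormal {d : ℕ} (hd : 1 ≤ d)
    (K : AffineBasis (Fin (d + 1)) ℝ (E d)) (i : Fin (d + 1)) :
    ∃! n, IsOutwardUnitNormal K i n := by
  obtain ⟨d, rfl⟩ : ∃ e, d = e + 1 := ⟨d - 1, by omega⟩
  set g : E (d + 1) := (InnerProductSpace.toDual ℝ (E (d + 1))).symm
    (LinearMap.toContinuousLinearMap (K.coord i).linear) with hg
  have key : ∀ j k, inner ℝ g (K j - K k) = K.coord i (K j) - K.coord i (K k) := by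
    intro j k
    have h := (K.coord i).linearMap_vsub (K j) (K k)
    rw [hg, InnerProductSpace.toDual_symm_apply]
    simpa using h
  obtain ⟨j₀, hj₀⟩ := exists_ne i
  have hg0 : g ≠ 0 := by
    intro h
    have := key i j₀
    rw [h] at this
    simp [K.coord_apply_ne hj₀.symm] at this
  have hpos : 0 < ‖g‖ := norm_pos_iff.2 hg0
  have hn : IsOutwardUnitNormal K i (-(‖g‖⁻¹ • g)) := by
    refine ⟨?_, ?_, ?_⟩
    · rw [norm_neg, norm_smul, norm_inv, norm_norm, inv_mul_cancel₀ hpos.ne']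
    · intro j k hj hk
      rw [inner_neg_left, real_inner_smul_left, key, K.coord_apply_ne hj.symm,
        K.coord_apply_ne hk.symm]
      simp
    · intro j hj
      rw [inner_neg_left, real_inner_smul_left, key, K.coord_apply_ne hj.symm]
      simpa using hpos
  refine ⟨_, hn, ?_⟩
  -- a vector with the three properties is determined by its pairing with the edges at `x_{j₀}`
  have hspan : ∀ w : E (d + 1), (∀ k, inner ℝ w (K k - K j₀) = 0) → w = 0 := by
    intro w hw
    have htop : (innerₛₗ ℝ w : E (d + 1) →ₗ[ℝ] ℝ) = 0 := by
      refine (K.basisOf j₀).ext fun k => ?_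
      simpa using hw k
    have : inner ℝ w w = (0 : ℝ) := by
      have := LinearMap.congr_fun htop w
      simpa using this
    simpa using this
  intro m hm
  have ha := hm.outward j₀ hj₀
  have hb := hn.outward j₀ hj₀
  set n := -(‖g‖⁻¹ • g) with hndef
  set a := inner ℝ m (K i - K j₀) with hadef
  set b := inner ℝ n (K i - K j₀) with hbdef
  have heq : b • m - a • n = 0 := by
    refine hspan _ fun k => ?_
    rw [inner_sub_left, real_inner_smul_left, real_inner_smul_left]
    by_cases hk : k = i
    · subst hk
      rw [← hadef, ← hbdef]; ring
    · rw [hm.normal k j₀ hk hj₀, hn.normal k j₀ hk hj₀]; ring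
  have heq' : b • m = a • n := sub_eq_zero.1 heq
  have hab : |b| = |a| := by
    have := congrArg norm heq'
    rwa [norm_smul, norm_smul, hm.norm_eq_one, hn.norm_eq_one, mul_one, mul_one] at this
  rw [abs_of_neg hb, abs_of_neg ha] at hab
  have hba : b = a := by linarith
  rw [hba] at heq'
  exact smul_right_injective _ ha.ne heq'

end

end MacroBubble

namespace MacroBubble

noncomputable section

/-! ### Weak derivatives of Lipschitz functions -/

/-! Let λ₀ = `apexHat` and λₖ = `vertexHat` be the piecewise linear nodal functions of the
refinement, and aₖ = μₖ(x₀). On ∂K one has λ₀ = 0 and λₖ = μₖ, so P = ∏_{k≠i} λₖ agrees there with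
Bᵢ, and P vanishes off Kᵢ because λⱼ = 0 on Kⱼ. Thus P n has the right trace. It remains to subtract
a continuous piecewise polynomial field of degree ≤ d that vanishes on ∂K and has the same
divergence up to a constant.

On Kᵢ the divergence of P n is ∑_{k≠i} (∂ₙλₖ) ∏_{l≠i,k} λₗ. Each term is covered by
`isDivModConst_indicator`: for i ∈ S and |S| ≥ 2, the function equal to λ₀^(|S|-2) ∏_{l∉S} λₗ on Kᵢ
and 0 on the other cells is, modulo constants, the divergence of an admissible field. The proof is
by induction on |Sᶜ|. With p = |S| - 2 and m ∉ S, differentiating λ₀^(p+1) ∏_{l∉S} λₗ along Kᵢ - x₀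
and along Kₘ - x₀ and subtracting cancels the common term -(p+1) λ₀^p ∏_{l∉S} λₗ. What is left is
the desired function plus terms of the same kind for sets S ∪ {l}. The base case S = everything
leaves a multiple of λ₀^(d-1), handled by the radial fields λ₀^(k+1) (x - x₀) in
`isDivModConst_apexHat_pow`.

For the estimate, fields are written ∑ fₘ (Kₘ - x₀), with fₘ bounded by M and Lipschitz with
constant M G, where G bounds the gradients of the hat functions. For d ≥ 2 shape regularity gives G
= σ²/h with h = diam K (`gradBound_of_refinementShapeConst_le`). Combined with the lower bound
`le_h1Norm_faceBubble`, all powers of h are absorbed. For d = 1 the two cells need not be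
comparable, but bᵢ is affine and β = bᵢ works. -/

theorem integrable_mul_of_hasCompactSupport {d : ℕ} {U : Set (E d)} {g φ : E d → ℝ}
    (hg : LocallyIntegrableOn g U volume) (hφ : Continuous φ) (hc : HasCompactSupport φ)
    (hs : tsupport φ ⊆ U) : Integrable (fun x => φ x * g x) volume := by
  have h1 := hg.integrableOn_compact_subset hs hc
  have h2 : IntegrableOn (fun x => φ x * g x) (tsupport φ) volume :=
    h1.continuousOn_mul hφ.continuousOn hc
  refine (integrableOn_iff_integrable_of_support_subset fun x hx => ?_).1 h2
  exact subset_tsupport φ (left_ne_zero_of_mul hx)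

/-- Extending f to a Lipschitz function on the whole space reduces this to integration by parts
against φ there; supp φ ⊆ U removes boundary terms. Since piecewise polynomial fields will be
Lipschitz on all of K, no interface terms between cells have to be computed. -/
theorem hasWeakPartial_of_lipschitzOnWith {d : ℕ} {U T : Set (E d)} (hU : IsOpen U) (hUT : U ⊆ T)
    {C : NNReal} {f : E d → ℝ} (hf : LipschitzOnWith C f T) (j : Fin d) :
    HasWeakPartial U j f fun x => lineDeriv ℝ f x (EuclideanSpace.single j 1) := by
  obtain ⟨F, hF, hfF⟩ := hf.extend_real
  set e : E d := EuclideanSpace.single j 1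
  have hd : EqOn (fun x => lineDeriv ℝ F x e) (fun x => lineDeriv ℝ f x e) U := by
    intro x hx
    refine Filter.EventuallyEq.lineDeriv_eq ?_
    filter_upwards [hU.mem_nhds hx] with y hy using (hfF (hUT hy)).symm
  refine ⟨?_, ?_, ?_⟩
  · exact (hF.continuous.locallyIntegrable.locallyIntegrableOn U).congr
      (ae_restrict_of_forall_mem hU.measurableSet fun x hx => (hfF (hUT hx)).symm)
  · exact ((hF.locallyIntegrable_lineDeriv e).locallyIntegrableOn U).congr
      (ae_restrict_of_forall_mem hU.measurableSet hd)
  · intro φ hφ hc hs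
    obtain ⟨D, hD⟩ := ContDiff.lipschitzWith_of_hasCompactSupport hc hφ (by simp)
    have key := hF.integral_lineDeriv_mul_eq (μ := volume) hD hc e
    have h1 : ∫ x in U, f x * fderiv ℝ φ x e = ∫ x in U, F x * fderiv ℝ φ x e :=
      setIntegral_congr_fun hU.measurableSet fun x hx => by
        rw [hfF (hUT hx)]
    have h2 : ∫ x in U, lineDeriv ℝ f x e * φ x = ∫ x in U, lineDeriv ℝ F x e * φ x :=
      setIntegral_congr_fun hU.measurableSet fun x hx => by
        have := hd hx
        change lineDeriv ℝ F x e = lineDeriv ℝ f x e at this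
        change lineDeriv ℝ f x e * _ = _
        rw [this]
    rw [h1, h2, setIntegral_eq_integral_of_forall_compl_eq_zero,
      setIntegral_eq_integral_of_forall_compl_eq_zero, key, ← integral_neg]
    · refine integral_congr_ae (Filter.Eventually.of_forall fun x => ?_)
      have : DifferentiableAt ℝ φ x := hφ.differentiable (by simp) x
      simp only [this.lineDeriv_eq_fderiv, map_neg]
      ring
    · intro x hx
      rw [image_eq_zero_of_notMem_tsupport fun h => hx (hs h), mul_zero]
    · intro x hx
      have : x ∉ tsupport (fderiv ℝ φ) := fun h => hx (hs (tsupport_fderiv_subset ℝ h))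
      rw [image_eq_zero_of_notMem_tsupport this]
      simp

/-- The fundamental lemma of the calculus of variations. It is needed because `weakPartial` is an
arbitrary choice among the weak derivatives. -/
theorem HasWeakPartial.ae_eq {d : ℕ} {U : Set (E d)} (hU : IsOpen U) {j : Fin d}
    {f g g' : E d → ℝ} (h : HasWeakPartial U j f g) (h' : HasWeakPartial U j f g') :
    g =ᵐ[volume.restrict U] g' := by
  have key := hU.ae_eq_zero_of_integral_contDiff_smul_eq_zero (μ := volume) (f := g - g')
    (h.2.1.sub h'.2.1) ?_
  · rw [Filter.EventuallyEq, ae_restrict_iff' hU.measurableSet]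
    filter_upwards [key] with x hx hxU
    exact sub_eq_zero.1 (hx hxU)
  · intro φ hφ hc hs
    have i1 : Integrable (fun x => φ x * g x) (volume.restrict U) :=
      (integrable_mul_of_hasCompactSupport h.2.1 hφ.continuous hc hs).restrict
    have i2 : Integrable (fun x => φ x * g' x) (volume.restrict U) :=
      (integrable_mul_of_hasCompactSupport h'.2.1 hφ.continuous hc hs).restrict
    have e1 := h.2.2 φ hφ hc hs
    have e2 := h'.2.2 φ hφ hc hs
    rw [e1, neg_inj] at e2
    rw [← setIntegral_eq_integral_of_forall_compl_eq_zero (s := U)]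
    · have : ∀ x, φ x • (g - g') x = φ x * g x - φ x * g' x := fun x => by
        simp [mul_sub]
      simp only [this]
      rw [integral_sub i1 i2]
      simp only [mul_comm (φ _)]
      rw [e2, sub_self]
    · intro x hx
      rw [image_eq_zero_of_notMem_tsupport fun h => hx (hs h), zero_smul]

theorem weakPartial_ae_eq {d : ℕ} {U T : Set (E d)} (hU : IsOpen U) (hUT : U ⊆ T)
    {C : NNReal} {f : E d → ℝ} (hf : LipschitzOnWith C f T) (j : Fin d) :
    weakPartial U j f =ᵐ[volume.restrict U]
      fun x => lineDeriv ℝ f x (EuclideanSpace.single j 1) := by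
  have h := hasWeakPartial_of_lipschitzOnWith hU hUT hf j
  have hex : ∃ g, HasWeakPartial U j f g := ⟨_, h⟩
  rw [weakPartial, dif_pos hex]
  exact hex.choose_spec.ae_eq hU h

theorem norm_lineDeriv_single_le {d : ℕ} {U T : Set (E d)} (hU : IsOpen U) (hUT : U ⊆ T)
    {C : NNReal} {f : E d → ℝ} (hf : LipschitzOnWith C f T) (j : Fin d) {x : E d} (hx : x ∈ U) :
    |lineDeriv ℝ f x (EuclideanSpace.single j 1)| ≤ C := by
  have := norm_lineDeriv_le_of_lipschitzOn (𝕜 := ℝ) (v := EuclideanSpace.single j (1 : ℝ))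
    (Filter.mem_of_superset (hU.mem_nhds hx) hUT) hf
  simpa using this

theorem aestronglyMeasurable_lineDeriv_single {d : ℕ} {U T : Set (E d)} (hU : IsOpen U)
    (hUT : U ⊆ T) {C : NNReal} {f : E d → ℝ} (hf : LipschitzOnWith C f T) (j : Fin d) :
    AEStronglyMeasurable (fun x => lineDeriv ℝ f x (EuclideanSpace.single j 1))
      (volume.restrict U) :=
  (hasWeakPartial_of_lipschitzOnWith hU hUT hf j).2.1.aestronglyMeasurable

theorem memH1_of_lipschitzOnWith {d : ℕ} {U T : Set (E d)} (hU : IsOpen U) (hUT : U ⊆ T)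
    (hT : Bornology.IsBounded T) {C : NNReal} {f : E d → ℝ} (hf : LipschitzOnWith C f T) :
    MemH1 U f := by
  have hfin : IsFiniteMeasure (volume.restrict U) :=
    ⟨by simpa using (hT.subset hUT).measure_lt_top⟩
  refine ⟨?_, fun j => ⟨_, hasWeakPartial_of_lipschitzOnWith hU hUT hf j, ?_⟩⟩
  · obtain ⟨F, hF, hfF⟩ := hf.extend_real
    have hb : Bornology.IsBounded (f '' T) := by
      rw [hfF.image_eq]
      exact hF.isBounded_image hT
    obtain ⟨M, hM⟩ := hb.exists_norm_le
    refine MemLp.of_bound ((hf.continuousOn.mono hUT).aestronglyMeasurable hU.measurableSet) M ?_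
    filter_upwards [ae_restrict_mem hU.measurableSet] with x hx
    exact hM _ (mem_image_of_mem f (hUT hx))
  · refine MemLp.of_bound (aestronglyMeasurable_lineDeriv_single hU hUT hf j) C ?_
    filter_upwards [ae_restrict_mem hU.measurableSet] with x hx
    exact norm_lineDeriv_single_le hU hUT hf j hx

/-! ### The simplex in barycentric coordinates -/

section Coordinates

variable {d : ℕ} (K : AffineBasis (Fin (d + 1)) ℝ (E d))

theorem simplex_eq : simplex K = {x | ∀ k, 0 ≤ K.coord k x} :=
  K.convexHull_eq_nonneg_coord

theorem interior_simplex_eq : interior (simplex K) = {x | ∀ k, 0 < K.coord k x} :=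
  K.interior_convexHull

theorem isCompact_simplex : IsCompact (simplex K) :=
  (finite_range K).isCompact_convexHull ℝ

theorem coord_le_one {x : E d} (hx : x ∈ simplex K) (k : Fin (d + 1)) : K.coord k x ≤ 1 := by
  rw [simplex_eq] at hx
  rw [← K.sum_coord_apply_eq_one x]
  exact Finset.single_le_sum (f := fun k => K.coord k x) (fun k _ => hx k) (Finset.mem_univ k)

theorem exists_coord_eq_zero {x : E d} (hx : x ∈ frontier (simplex K)) :
    x ∈ simplex K ∧ ∃ k, K.coord k x = 0 := by
  have hK : x ∈ simplex K := (isCompact_simplex K).isClosed.frontier_subset hx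
  refine ⟨hK, ?_⟩
  by_contra! h
  refine hx.2 ?_
  rw [interior_simplex_eq]
  rw [simplex_eq] at hK
  exact fun k => (hK k).lt_of_ne (h k).symm

/-- The gradient of a barycentric coordinate. -/
def dcoord (k : Fin (d + 1)) : E d →L[ℝ] ℝ := LinearMap.toContinuousLinearMap (K.coord k).linear

theorem dcoord_sub (k : Fin (d + 1)) (x y : E d) :
    dcoord K k (x - y) = K.coord k x - K.coord k y := by
  simpa [dcoord] using (K.coord k).linearMap_vsub x y

theorem coord_add (k : Fin (d + 1)) (x w : E d) :
    K.coord k (x + w) = K.coord k x + dcoord K k w := by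
  have := dcoord_sub K k (x + w) x
  rw [add_sub_cancel_left] at this
  linarith

theorem hasFDerivAt_coord (k : Fin (d + 1)) (x : E d) :
    HasFDerivAt (K.coord k) (dcoord K k) x := by
  have h : (K.coord k : E d → ℝ) = fun y => K.coord k 0 + dcoord K k y := by
    ext y
    simpa using coord_add K k 0 y
  rw [h]
  exact (dcoord K k).hasFDerivAt.const_add _

theorem continuous_coord (k : Fin (d + 1)) : Continuous (K.coord k) :=
  continuous_iff_continuousAt.2 fun x => (hasFDerivAt_coord K k x).continuousAt

theorem dcoord_vertex_sub (x₀ : E d) (k m : Fin (d + 1)) :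
    dcoord K k (K m - x₀) = (if k = m then 1 else 0) - K.coord k x₀ := by
  rw [dcoord_sub, K.coord_apply]

theorem sum_coord_smul (x : E d) : ∑ k, K.coord k x • K k = x :=
  K.linear_combination_coord_eq_self x

end Coordinates

/-! ### Sectors and hat functions of the refinement -/

section Hats

variable {d : ℕ} (K : AffineBasis (Fin (d + 1)) ℝ (E d)) (x₀ : E d)

/-- The cone with apex `x₀` over the `j`-th face. -/
def sector (j : Fin (d + 1)) : Set (E d) :=
  {x | ∀ k, K.coord j x / K.coord j x₀ ≤ K.coord k x / K.coord k x₀}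

/-- The interior of the cone with apex `x₀` over the `j`-th face. -/
def openSector (j : Fin (d + 1)) : Set (E d) :=
  {x | ∀ k, k ≠ j → K.coord j x / K.coord j x₀ < K.coord k x / K.coord k x₀}

/-- The piecewise linear function that is `1` at `x₀` and vanishes on the boundary of `K`. -/
def apexHat (x : E d) : ℝ :=
  Finset.univ.inf' Finset.univ_nonempty fun j => K.coord j x / K.coord j x₀

/-- The piecewise linear function that is `1` at the `k`-th vertex of `K` and vanishes at the
other vertices of the refinement. -/
def vertexHat (k : Fin (d + 1)) (x : E d) : ℝ :=
  K.coord k x - K.coord k x₀ * apexHat K x₀ x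

/-- The gradient of `apexHat` on the `j`-th sector. -/
def apexGrad (j : Fin (d + 1)) : E d →L[ℝ] ℝ := (K.coord j x₀)⁻¹ • dcoord K j

/-- The gradient of `vertexHat` on the `j`-th sector. -/
def vertexGrad (j k : Fin (d + 1)) : E d →L[ℝ] ℝ :=
  dcoord K k - K.coord k x₀ • apexGrad K x₀ j

theorem apexGrad_apply (j : Fin (d + 1)) (w : E d) :
    apexGrad K x₀ j w = (K.coord j x₀)⁻¹ * dcoord K j w := rfl

theorem vertexGrad_apply (j k : Fin (d + 1)) (w : E d) :
    vertexGrad K x₀ j k w = dcoord K k w - K.coord k x₀ * apexGrad K x₀ j w := rfl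

theorem openSector_subset_sector (j : Fin (d + 1)) : openSector K x₀ j ⊆ sector K x₀ j := by
  intro x hx k
  rcases eq_or_ne k j with rfl | h
  exacts [le_rfl, (hx k h).le]

theorem isOpen_openSector (j : Fin (d + 1)) : IsOpen (openSector K x₀ j) := by
  have : openSector K x₀ j = ⋂ k, {x | k ≠ j → K.coord j x / K.coord j x₀ <
      K.coord k x / K.coord k x₀} := by
    ext x; simp [openSector]
  rw [this]
  refine isOpen_iInter_of_finite fun k => ?_
  by_cases h : k = j
  · simp [h]
  · simp only [ne_eq, h, not_false_eq_true, forall_const]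
    exact isOpen_lt ((continuous_coord K j).div_const _) ((continuous_coord K k).div_const _)

theorem apexHat_le (x : E d) (j : Fin (d + 1)) :
    apexHat K x₀ x ≤ K.coord j x / K.coord j x₀ :=
  Finset.inf'_le (fun j => K.coord j x / K.coord j x₀) (Finset.mem_univ j)

theorem apexHat_eq {j : Fin (d + 1)} {x : E d} (hx : x ∈ sector K x₀ j) :
    apexHat K x₀ x = K.coord j x / K.coord j x₀ :=
  le_antisymm (apexHat_le K x₀ x j) (Finset.le_inf' _ _ fun k _ => hx k)

theorem exists_mem_sector (x : E d) : ∃ j, x ∈ sector K x₀ j := by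
  obtain ⟨j, hj⟩ := Finite.exists_min fun j => K.coord j x / K.coord j x₀
  exact ⟨j, hj⟩

theorem sum_vertexHat (x : E d) : ∑ k, vertexHat K x₀ k x = 1 - apexHat K x₀ x := by
  simp only [vertexHat, Finset.sum_sub_distrib, K.sum_coord_apply_eq_one, ← Finset.sum_mul,
    one_mul]

variable {x₀}

theorem coord_pos (hx₀ : x₀ ∈ interior (simplex K)) (k : Fin (d + 1)) : 0 < K.coord k x₀ := by
  rw [interior_simplex_eq] at hx₀
  exact hx₀ k

variable {K}

theorem vertexHat_eq_zero (hx₀ : x₀ ∈ interior (simplex K)) {j : Fin (d + 1)} {x : E d}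
    (hx : x ∈ sector K x₀ j) : vertexHat K x₀ j x = 0 := by
  rw [vertexHat, apexHat_eq K x₀ hx, mul_div_cancel₀ _ (coord_pos K hx₀ j).ne', sub_self]

theorem vertexHat_nonneg (hx₀ : x₀ ∈ interior (simplex K)) (k : Fin (d + 1)) (x : E d) :
    0 ≤ vertexHat K x₀ k x := by
  have h := apexHat_le K x₀ x k
  rw [le_div_iff₀ (coord_pos K hx₀ k)] at h
  rw [vertexHat]
  linarith

theorem apexHat_nonneg (hx₀ : x₀ ∈ interior (simplex K)) {x : E d} (hx : x ∈ simplex K) :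
    0 ≤ apexHat K x₀ x := by
  rw [simplex_eq] at hx
  exact Finset.le_inf' _ _ fun k _ => div_nonneg (hx k) (coord_pos K hx₀ k).le

theorem apexHat_le_one (hx₀ : x₀ ∈ interior (simplex K)) (x : E d) : apexHat K x₀ x ≤ 1 := by
  have h := sum_vertexHat K x₀ x
  have : 0 ≤ ∑ k, vertexHat K x₀ k x := Finset.sum_nonneg fun k _ => vertexHat_nonneg hx₀ k x
  linarith

theorem vertexHat_le_one (hx₀ : x₀ ∈ interior (simplex K)) {x : E d} (hx : x ∈ simplex K)
    (k : Fin (d + 1)) : vertexHat K x₀ k x ≤ 1 := by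
  have h := coord_le_one K hx k
  have := mul_nonneg (coord_pos K hx₀ k).le (apexHat_nonneg hx₀ hx)
  rw [vertexHat]
  linarith

theorem apexHat_eq_zero (hx₀ : x₀ ∈ interior (simplex K)) {x : E d}
    (hx : x ∈ frontier (simplex K)) : apexHat K x₀ x = 0 := by
  obtain ⟨hK, k, hk⟩ := exists_coord_eq_zero K hx
  refine le_antisymm ?_ (apexHat_nonneg hx₀ hK)
  simpa [hk] using apexHat_le K x₀ x k

theorem hasFDerivAt_apexHat {j : Fin (d + 1)} {x : E d} (hx : x ∈ openSector K x₀ j) :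
    HasFDerivAt (apexHat K x₀) (apexGrad K x₀ j) x := by
  have h : HasFDerivAt ((K.coord j x₀)⁻¹ • K.coord j : E d → ℝ) (apexGrad K x₀ j) x :=
    (hasFDerivAt_coord K j x).const_smul _
  refine h.congr_of_eventuallyEq ?_
  filter_upwards [(isOpen_openSector K x₀ j).mem_nhds hx] with y hy
  rw [apexHat_eq K x₀ (openSector_subset_sector K x₀ j hy), Pi.smul_apply, smul_eq_mul,
    div_eq_inv_mul]

theorem hasFDerivAt_vertexHat {j : Fin (d + 1)} (k : Fin (d + 1)) {x : E d}
    (hx : x ∈ openSector K x₀ j) :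
    HasFDerivAt (vertexHat K x₀ k) (vertexGrad K x₀ j k) x :=
  (hasFDerivAt_coord K k x).sub ((hasFDerivAt_apexHat hx).const_smul (K.coord k x₀))

/-- The affine function that equals λ₀ on sector j is 1 at x₀, 0 at the vertices of the j-th face
and 1/aⱼ at Kⱼ. -/
theorem apexGrad_vertex_sub (hx₀ : x₀ ∈ interior (simplex K)) (j m : Fin (d + 1)) :
    apexGrad K x₀ j (K m - x₀) = (if j = m then (K.coord j x₀)⁻¹ else 0) - 1 := by
  have := (coord_pos K hx₀ j).ne'
  simp only [apexGrad_apply, dcoord_vertex_sub]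
  split_ifs <;> field_simp
  ring

theorem vertexGrad_vertex_sub (hx₀ : x₀ ∈ interior (simplex K)) (j k m : Fin (d + 1)) :
    vertexGrad K x₀ j k (K m - x₀) =
      (if k = m then 1 else 0) - (if j = m then K.coord k x₀ / K.coord j x₀ else 0) := by
  simp only [vertexGrad_apply, dcoord_vertex_sub, apexGrad_vertex_sub hx₀]
  split_ifs <;> ring

/-- Almost every point lies in the interior of a sector. -/
theorem ae_exists_mem_openSector (hx₀ : x₀ ∈ interior (simplex K)) :
    ∀ᵐ x ∂(volume : Measure (E d)), ∃ j, x ∈ openSector K x₀ j := by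
  have hnull : ∀ j k, k ≠ j → ∀ᵐ x ∂(volume : Measure (E d)),
      K.coord j x / K.coord j x₀ ≠ K.coord k x / K.coord k x₀ := by
    intro j k hjk
    set ℓ : E d →L[ℝ] ℝ := apexGrad K x₀ j - apexGrad K x₀ k
    -- The points where the two ratios agree form a hyperplane through x₀. It is proper because ℓ
    -- (Kⱼ - x₀) = 1/aⱼ ≠ 0.
    have hne : AffineSubspace.mk' x₀ (LinearMap.ker (ℓ : E d →ₗ[ℝ] ℝ)) ≠ ⊤ := by
      intro h
      have hm : K j ∈ AffineSubspace.mk' x₀ (LinearMap.ker (ℓ : E d →ₗ[ℝ] ℝ)) := by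
        rw [h]; trivial
      rw [AffineSubspace.mem_mk', LinearMap.mem_ker] at hm
      have h2 : ℓ (K j - x₀) = 0 := hm
      change apexGrad K x₀ j _ - apexGrad K x₀ k _ = 0 at h2
      simp only [apexGrad_vertex_sub hx₀, if_true, if_neg hjk] at h2
      have := inv_pos.2 (coord_pos K hx₀ j)
      linarith
    have h0 := Measure.addHaar_affineSubspace volume _ hne
    rw [ae_iff]
    refine measure_mono_null ?_ h0
    intro x hx
    rw [mem_ofPred_eq, not_not] at hx
    rw [SetLike.mem_coe, AffineSubspace.mem_mk', LinearMap.mem_ker]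
    change apexGrad K x₀ j (x - x₀) - apexGrad K x₀ k (x - x₀) = 0
    have hj := (coord_pos K hx₀ j).ne'
    have hk := (coord_pos K hx₀ k).ne'
    rw [apexGrad_apply, apexGrad_apply, dcoord_sub, dcoord_sub, mul_sub, mul_sub, inv_mul_cancel₀ hj, inv_mul_cancel₀ hk, ← div_eq_inv_mul,
      ← div_eq_inv_mul, hx]
    ring
  have hall : ∀ᵐ x ∂(volume : Measure (E d)), ∀ j k, k ≠ j →
      K.coord j x / K.coord j x₀ ≠ K.coord k x / K.coord k x₀ := by
    rw [ae_all_iff]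
    intro j
    rw [ae_all_iff]
    intro k
    by_cases h : k = j
    · simp [h]
    · filter_upwards [hnull j k h] with x hx _ using hx
  filter_upwards [hall] with x hx
  obtain ⟨j, hj⟩ := exists_mem_sector K x₀ x
  exact ⟨j, fun k hk => (hj k).lt_of_ne (hx j k hk)⟩

theorem cell_subset (hx₀ : x₀ ∈ interior (simplex K)) (j : Fin (d + 1)) :
    cell K x₀ j ⊆ simplex K ∩ sector K x₀ j := by
  have hpos := coord_pos K hx₀
  refine convexHull_min ?_ ((convex_convexHull ℝ _).inter ?_)
  · refine insert_subset ⟨interior_subset hx₀, fun k => ?_⟩ ?_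
    · rw [div_self (hpos j).ne', div_self (hpos k).ne']
    · rintro _ ⟨m, hm, rfl⟩
      refine ⟨subset_convexHull ℝ _ (mem_range_self m), fun k => ?_⟩
      rw [K.coord_apply_ne (Ne.symm hm), zero_div]
      refine div_nonneg ?_ (hpos k).le
      rw [K.coord_apply]
      split_ifs <;> norm_num
  · have : sector K x₀ j = ⋂ k, {x | apexGrad K x₀ j x - apexGrad K x₀ k x ≤
        apexGrad K x₀ j x₀ - apexGrad K x₀ k x₀} := by
      ext x
      simp only [sector, mem_ofPred_eq, mem_iInter]
      refine forall_congr' fun k => ?_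
      have e : ∀ l, K.coord l x / K.coord l x₀ = apexGrad K x₀ l x - apexGrad K x₀ l x₀ + 1 := by
        intro l
        rw [← map_sub, apexGrad_apply, dcoord_sub, mul_sub,
          inv_mul_cancel₀ (hpos l).ne', div_eq_inv_mul]
        ring
      rw [e, e]
      constructor <;> intro h <;> linarith
    rw [this]
    exact convex_iInter fun k =>
      convex_halfSpace_le (f := fun x => apexGrad K x₀ j x - apexGrad K x₀ k x)
        (apexGrad K x₀ j - apexGrad K x₀ k).isBoundedLinearMap.toIsLinearMap _

end Hats

/-! ### Polynomials in the hat functions -/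

section Polynomials

variable {d : ℕ}

theorem IsPolyOn.mono {k l : ℕ} (h : k ≤ l) {T : Set (E d)} {f : E d → ℝ} (hf : IsPolyOn k T f) :
    IsPolyOn l T f :=
  let ⟨p, hp, hf⟩ := hf
  ⟨p, hp.trans h, hf⟩

theorem IsPolyOn.congr {k : ℕ} {T : Set (E d)} {f g : E d → ℝ} (hf : IsPolyOn k T f)
    (h : ∀ x ∈ T, g x = f x) : IsPolyOn k T g :=
  let ⟨p, hp, hf⟩ := hf
  ⟨p, hp, fun x hx => (h x hx).trans (hf x hx)⟩

theorem IsPolyOn.const {T : Set (E d)} (c : ℝ) : IsPolyOn 0 T fun _ => c :=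
  ⟨MvPolynomial.C c, by simp, by simp⟩

theorem IsPolyOn.add {k : ℕ} {T : Set (E d)} {f g : E d → ℝ} (hf : IsPolyOn k T f)
    (hg : IsPolyOn k T g) : IsPolyOn k T fun x => f x + g x := by
  obtain ⟨p, hp, hf⟩ := hf
  obtain ⟨q, hq, hg⟩ := hg
  refine ⟨p + q, (MvPolynomial.totalDegree_add p q).trans (max_le hp hq), fun x hx => ?_⟩
  simp only [map_add, hf x hx, hg x hx]

theorem IsPolyOn.mul {k l : ℕ} {T : Set (E d)} {f g : E d → ℝ} (hf : IsPolyOn k T f)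
    (hg : IsPolyOn l T g) : IsPolyOn (k + l) T fun x => f x * g x := by
  obtain ⟨p, hp, hf⟩ := hf
  obtain ⟨q, hq, hg⟩ := hg
  refine ⟨p * q, (MvPolynomial.totalDegree_mul p q).trans (add_le_add hp hq), fun x hx => ?_⟩
  simp only [map_mul, hf x hx, hg x hx]

theorem IsPolyOn.const_mul {k : ℕ} {T : Set (E d)} (c : ℝ) {f : E d → ℝ} (hf : IsPolyOn k T f) :
    IsPolyOn k T fun x => c * f x := by
  simpa using (IsPolyOn.const c).mul hf

theorem IsPolyOn.sum {ι : Type*} {k : ℕ} {T : Set (E d)} (s : Finset ι) {f : ι → E d → ℝ}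
    (hf : ∀ i ∈ s, IsPolyOn k T (f i)) : IsPolyOn k T fun x => ∑ i ∈ s, f i x := by
  classical
  induction s using Finset.induction_on with
  | empty => simpa using (IsPolyOn.const (T := T) (0 : ℝ)).mono (Nat.zero_le k)
  | insert a s ha ih =>
    simp only [Finset.sum_insert ha]
    exact (hf a (Finset.mem_insert_self a s)).add
      (ih fun i hi => hf i (Finset.mem_insert_of_mem hi))

theorem isPolyOn_coord (K : AffineBasis (Fin (d + 1)) ℝ (E d)) (k : Fin (d + 1)) (T : Set (E d)) :
    IsPolyOn 1 T (K.coord k) := by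
  have hX : ∀ j : Fin d, IsPolyOn 1 T fun x => x j := fun j =>
    ⟨MvPolynomial.X j, by simp, by simp⟩
  have h := (IsPolyOn.sum Finset.univ fun j _ =>
    (hX j).const_mul (dcoord K k (EuclideanSpace.single j 1))).add
      ((IsPolyOn.const (K.coord k 0)).mono zero_le_one)
  refine h.congr fun x _ => ?_
  have h1 := coord_add K k 0 x
  rw [zero_add] at h1
  rw [h1, add_comm]
  congr 1
  have hx : x = ∑ j, x j • EuclideanSpace.single j (1 : ℝ) := by
    ext l
    simp [Pi.single_apply]
  conv_lhs => rw [hx]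
  simp only [map_sum, map_smul, smul_eq_mul, mul_comm]

end Polynomials

section HatPolynomials

variable {d : ℕ} {K : AffineBasis (Fin (d + 1)) ℝ (E d)} {x₀ : E d} {G : ℝ}

/-- `G` bounds the gradients of all hat functions of the refinement. -/
structure GradBound (K : AffineBasis (Fin (d + 1)) ℝ (E d)) (x₀ : E d) (G : ℝ) : Prop where
  nonneg : 0 ≤ G
  apex : ∀ j w, |apexGrad K x₀ j w| ≤ G * ‖w‖
  vertex : ∀ j k w, |vertexGrad K x₀ j k w| ≤ G * ‖w‖

theorem GradBound.abs_apexHat_sub_le (hG : GradBound K x₀ G) (x y : E d) :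
    |apexHat K x₀ x - apexHat K x₀ y| ≤ G * ‖x - y‖ := by
  have key : ∀ x y : E d, apexHat K x₀ x - apexHat K x₀ y ≤ G * ‖x - y‖ := by
    intro x y
    -- λ₀ is a minimum of affine functions: the one active at y bounds λ₀ above at x and equals it
    -- at y.
    obtain ⟨j, hj⟩ := exists_mem_sector K x₀ y
    have h1 := apexHat_le K x₀ x j
    have h2 := (le_abs_self _).trans (hG.apex j (x - y))
    rw [apexGrad_apply, dcoord_sub, mul_sub, ← div_eq_inv_mul, ← div_eq_inv_mul] at h2
    rw [apexHat_eq K x₀ hj]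
    linarith
  exact abs_sub_le_iff.2 ⟨key x y, by rw [norm_sub_rev]; exact key y x⟩

theorem GradBound.abs_vertexHat_sub_le (hx₀ : x₀ ∈ interior (simplex K)) (hG : GradBound K x₀ G)
    (k : Fin (d + 1)) (x y : E d) :
    |vertexHat K x₀ k x - vertexHat K x₀ k y| ≤ G * ‖x - y‖ := by
  have key : ∀ x y : E d, vertexHat K x₀ k x - vertexHat K x₀ k y ≤ G * ‖x - y‖ := by
    intro x y
    -- λₖ is a maximum of affine functions, so here the piece active at x is the one to use.
    obtain ⟨j, hj⟩ := exists_mem_sector K x₀ x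
    have h1 := mul_le_mul_of_nonneg_left (apexHat_le K x₀ y j) (coord_pos K hx₀ k).le
    have h2 := (le_abs_self _).trans (hG.vertex j k (x - y))
    rw [vertexGrad_apply, apexGrad_apply, dcoord_sub, dcoord_sub, mul_sub _ (K.coord j x),
      ← div_eq_inv_mul, ← div_eq_inv_mul] at h2
    rw [vertexHat, vertexHat, apexHat_eq K x₀ hj]
    linarith
  exact abs_sub_le_iff.2 ⟨key x y, by rw [norm_sub_rev]; exact key y x⟩

/-- `f` is a piecewise polynomial of degree at most `k` on the refinement that is bounded by `M`
and Lipschitz with constant `M * G` on `K`. -/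
structure HatPoly (K : AffineBasis (Fin (d + 1)) ℝ (E d)) (x₀ : E d) (G : ℝ) (k : ℕ) (M : ℝ)
    (f : E d → ℝ) : Prop where
  abs_le : ∀ x ∈ simplex K, |f x| ≤ M
  lip : ∀ x ∈ simplex K, ∀ y ∈ simplex K, |f x - f y| ≤ M * G * ‖x - y‖
  poly : ∀ j, IsPolyOn k (cell K x₀ j) f
  diff : ∀ j, ∀ x ∈ openSector K x₀ j, DifferentiableAt ℝ f x

theorem HatPoly.nonneg {k : ℕ} {M : ℝ} {f : E d → ℝ} (hf : HatPoly K x₀ G k M f) : 0 ≤ M :=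
  (abs_nonneg _).trans (hf.abs_le (K 0) (subset_convexHull ℝ _ (mem_range_self 0)))

theorem HatPoly.mono (hG : 0 ≤ G) {k l : ℕ} {M N : ℝ} {f : E d → ℝ} (hf : HatPoly K x₀ G k M f)
    (hkl : k ≤ l) (hMN : M ≤ N) : HatPoly K x₀ G l N f where
  abs_le x hx := (hf.abs_le x hx).trans hMN
  lip x hx y hy := (hf.lip x hx y hy).trans (by gcongr)
  poly j := (hf.poly j).mono hkl
  diff := hf.diff

theorem HatPoly.add {k : ℕ} {M N : ℝ} {f g : E d → ℝ} (hf : HatPoly K x₀ G k M f)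
    (hg : HatPoly K x₀ G k N g) : HatPoly K x₀ G k (M + N) fun x => f x + g x where
  abs_le x hx := (abs_add_le _ _).trans (add_le_add (hf.abs_le x hx) (hg.abs_le x hx))
  lip x hx y hy := by
    have h1 := hf.lip x hx y hy
    have h2 := hg.lip x hx y hy
    have h3 := abs_add_le (f x - f y) (g x - g y)
    rw [show f x + g x - (f y + g y) = f x - f y + (g x - g y) by ring]
    linarith
  poly j := (hf.poly j).add (hg.poly j)
  diff j x hx := (hf.diff j x hx).add (hg.diff j x hx)

theorem HatPoly.const_mul {k : ℕ} {M : ℝ} {f : E d → ℝ} (c : ℝ) (hf : HatPoly K x₀ G k M f) :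
    HatPoly K x₀ G k (|c| * M) fun x => c * f x where
  abs_le x hx := by
    rw [abs_mul]
    exact mul_le_mul_of_nonneg_left (hf.abs_le x hx) (abs_nonneg c)
  lip x hx y hy := by
    rw [← mul_sub, abs_mul, mul_assoc, mul_assoc, ← mul_assoc M]
    exact mul_le_mul_of_nonneg_left (hf.lip x hx y hy) (abs_nonneg c)
  poly j := (hf.poly j).const_mul c
  diff j x hx := (hf.diff j x hx).const_mul c

/-- The factor 2 comes from the two terms of the product rule; it lets one constant control both the
supremum and the Lipschitz constant. -/
theorem HatPoly.mul (hG : 0 ≤ G) {k l : ℕ} {M N : ℝ} {f g : E d → ℝ} (hf : HatPoly K x₀ G k M f)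
    (hg : HatPoly K x₀ G l N g) : HatPoly K x₀ G (k + l) (2 * M * N) fun x => f x * g x where
  abs_le x hx := by
    rw [abs_mul]
    have := mul_le_mul (hf.abs_le x hx) (hg.abs_le x hx) (abs_nonneg _) hf.nonneg
    nlinarith [mul_nonneg hf.nonneg hg.nonneg]
  lip x hx y hy := by
    rw [show f x * g x - f y * g y = f x * (g x - g y) + (f x - f y) * g y by ring]
    refine (abs_add_le _ _).trans ?_
    rw [abs_mul, abs_mul]
    have h1 := mul_le_mul (hf.abs_le x hx) (hg.lip x hx y hy) (abs_nonneg _) hf.nonneg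
    have h2 := mul_le_mul (hf.lip x hx y hy) (hg.abs_le y hy) (abs_nonneg _)
      (mul_nonneg (mul_nonneg hf.nonneg hG) (norm_nonneg _))
    linarith
  poly j := (hf.poly j).mul (hg.poly j)
  diff j x hx := (hf.diff j x hx).mul (hg.diff j x hx)

theorem hatPoly_const (hG : 0 ≤ G) (c : ℝ) : HatPoly K x₀ G 0 |c| fun _ => c where
  abs_le x hx := le_rfl
  lip x hx y hy := by
    rw [sub_self, abs_zero]
    positivity
  poly j := IsPolyOn.const c
  diff j x hx := differentiableAt_const c

theorem HatPoly.sum {ι : Type*} (hG : 0 ≤ G) {k : ℕ} {M : ι → ℝ} (s : Finset ι) {f : ι → E d → ℝ}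
    (hf : ∀ i ∈ s, HatPoly K x₀ G k (M i) (f i)) :
    HatPoly K x₀ G k (∑ i ∈ s, M i) fun x => ∑ i ∈ s, f i x := by
  classical
  induction s using Finset.induction_on with
  | empty => simpa using (hatPoly_const (K := K) (x₀ := x₀) hG 0).mono hG (Nat.zero_le k) le_rfl
  | insert a s ha ih =>
    simp only [Finset.sum_insert ha]
    exact (hf a (Finset.mem_insert_self a s)).add
      (ih fun i hi => hf i (Finset.mem_insert_of_mem hi))

theorem HatPoly.pow (hG : 0 ≤ G) {f : E d → ℝ} (hf : HatPoly K x₀ G 1 1 f) (p : ℕ) :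
    HatPoly K x₀ G p (2 ^ p) fun x => f x ^ p := by
  induction p with
  | zero => simpa using hatPoly_const (K := K) (x₀ := x₀) hG 1
  | succ p ih =>
    simp only [pow_succ]
    exact (ih.mul hG hf).mono hG le_rfl (by linarith)

theorem HatPoly.prod (hG : 0 ≤ G) {ι : Type*} (s : Finset ι) {f : ι → E d → ℝ}
    (hf : ∀ i ∈ s, HatPoly K x₀ G 1 1 (f i)) :
    HatPoly K x₀ G s.card (2 ^ s.card) fun x => ∏ i ∈ s, f i x := by
  classical
  induction s using Finset.induction_on with
  | empty => simpa using hatPoly_const (K := K) (x₀ := x₀) hG 1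
  | insert a s ha ih =>
    simp only [Finset.prod_insert ha, Finset.card_insert_of_notMem ha]
    refine ((hf a (Finset.mem_insert_self a s)).mul hG
      (ih fun i hi => hf i (Finset.mem_insert_of_mem hi))).mono hG (by omega) ?_
    rw [pow_succ]
    linarith

theorem hatPoly_apexHat (hx₀ : x₀ ∈ interior (simplex K)) (hG : GradBound K x₀ G) :
    HatPoly K x₀ G 1 1 (apexHat K x₀) where
  abs_le x hx := abs_le.2 ⟨by linarith [apexHat_nonneg hx₀ hx], apexHat_le_one hx₀ x⟩
  lip x hx y hy := by
    rw [one_mul]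
    exact hG.abs_apexHat_sub_le x y
  poly j := by
    refine ((isPolyOn_coord K j _).const_mul (K.coord j x₀)⁻¹).congr fun x hx => ?_
    rw [apexHat_eq K x₀ (cell_subset hx₀ j hx).2, div_eq_inv_mul]
  diff j x hx := (hasFDerivAt_apexHat hx).differentiableAt

theorem hatPoly_vertexHat (hx₀ : x₀ ∈ interior (simplex K)) (hG : GradBound K x₀ G)
    (k : Fin (d + 1)) : HatPoly K x₀ G 1 1 (vertexHat K x₀ k) where
  abs_le x hx := abs_le.2 ⟨by linarith [vertexHat_nonneg hx₀ k x], vertexHat_le_one hx₀ hx k⟩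
  lip x hx y hy := by
    rw [one_mul]
    exact hG.abs_vertexHat_sub_le hx₀ k x y
  poly j := by
    refine ((isPolyOn_coord K k _).add (((hatPoly_apexHat hx₀ hG).poly j).const_mul
      (-K.coord k x₀))).congr fun x _ => ?_
    rw [vertexHat]
    ring
  diff j x hx := (hasFDerivAt_vertexHat k hx).differentiableAt

/-- The product of the vertex hat functions of all vertices outside `S`. -/
def hatProd (K : AffineBasis (Fin (d + 1)) ℝ (E d)) (x₀ : E d) (S : Finset (Fin (d + 1)))
    (x : E d) : ℝ :=
  ∏ k ∈ Sᶜ, vertexHat K x₀ k x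

/-- The product has p + (d + 1 - |S|) linear factors, which is at most d exactly when p + 1 ≤ |S|.
-/
theorem hatPoly_pow_mul_hatProd (hx₀ : x₀ ∈ interior (simplex K)) (hG : GradBound K x₀ G) (p : ℕ)
    {S : Finset (Fin (d + 1))} (hS : p + 1 ≤ S.card) :
    HatPoly K x₀ G d (2 ^ (d + 1)) fun x => apexHat K x₀ x ^ p * hatProd K x₀ S x := by
  have h := ((hatPoly_apexHat hx₀ hG).pow hG.nonneg p).mul hG.nonneg
    (HatPoly.prod hG.nonneg Sᶜ fun k _ => hatPoly_vertexHat hx₀ hG k)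
  have hc : Sᶜ.card = d + 1 - S.card := by rw [Finset.card_compl, Fintype.card_fin]
  have hle : S.card ≤ d + 1 := by simpa using S.card_le_univ
  refine h.mono hG.nonneg (by omega) ?_
  rw [mul_assoc, ← pow_add, ← pow_succ']
  exact pow_le_pow_right₀ one_le_two (by omega)

/-- A point of an open sector that is not a vertex of `S` annihilates `hatProd S` locally. -/
theorem hatProd_eq_zero (hx₀ : x₀ ∈ interior (simplex K)) {S : Finset (Fin (d + 1))}
    {j : Fin (d + 1)} (hj : j ∉ S) {x : E d} (hx : x ∈ openSector K x₀ j) :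
    hatProd K x₀ S x = 0 :=
  Finset.prod_eq_zero (Finset.mem_compl.2 hj)
    (vertexHat_eq_zero hx₀ (openSector_subset_sector K x₀ j hx))

theorem hasFDerivAt_pow_mul_hatProd (p : ℕ) (S : Finset (Fin (d + 1)))
    {j : Fin (d + 1)} {x : E d} (hx : x ∈ openSector K x₀ j) :
    HasFDerivAt (fun x => apexHat K x₀ x ^ p * hatProd K x₀ S x)
      (apexHat K x₀ x ^ p • (∑ k ∈ Sᶜ, hatProd K x₀ (insert k S) x • vertexGrad K x₀ j k) +
        hatProd K x₀ S x • ((p * apexHat K x₀ x ^ (p - 1)) • apexGrad K x₀ j)) x := by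
  have h1 : HasFDerivAt (hatProd K x₀ S)
      (∑ k ∈ Sᶜ, hatProd K x₀ (insert k S) x • vertexGrad K x₀ j k) x := by
    have := HasFDerivAt.finsetProd (u := Sᶜ) fun k _ => hasFDerivAt_vertexHat k hx
    refine this.congr_fderiv (Finset.sum_congr rfl fun k _ => ?_)
    rw [hatProd, Finset.compl_insert]
  have h2 := (hasFDerivAt_apexHat hx).pow p
  refine (h2.mul h1).congr_fderiv ?_
  simp [nsmul_eq_mul]

theorem fderiv_pow_mul_hatProd_apply (hx₀ : x₀ ∈ interior (simplex K)) (p : ℕ)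
    (S : Finset (Fin (d + 1))) {j : Fin (d + 1)} {x : E d} (hx : x ∈ openSector K x₀ j) (m : Fin (d + 1)) :
    fderiv ℝ (fun x => apexHat K x₀ x ^ p * hatProd K x₀ S x) x (K m - x₀) =
      apexHat K x₀ x ^ p * ((if m ∈ S then 0 else hatProd K x₀ (insert m S) x) -
        if j = m then ∑ k ∈ Sᶜ, K.coord k x₀ / K.coord j x₀ * hatProd K x₀ (insert k S) x else 0) +
      p * apexHat K x₀ x ^ (p - 1) * hatProd K x₀ S x *
        ((if j = m then (K.coord j x₀)⁻¹ else 0) - 1) := by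
  rw [(hasFDerivAt_pow_mul_hatProd p S hx).fderiv]
  change apexHat K x₀ x ^ p *
      (∑ k ∈ Sᶜ, hatProd K x₀ (insert k S) x • vertexGrad K x₀ j k) (K m - x₀) +
    hatProd K x₀ S x * ((p * apexHat K x₀ x ^ (p - 1)) * apexGrad K x₀ j (K m - x₀)) = _
  have h : (∑ k ∈ Sᶜ, hatProd K x₀ (insert k S) x • vertexGrad K x₀ j k) (K m - x₀) =
      (if m ∈ S then 0 else hatProd K x₀ (insert m S) x) -
        if j = m then ∑ k ∈ Sᶜ, K.coord k x₀ / K.coord j x₀ * hatProd K x₀ (insert k S) x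
        else 0 := by
    rw [sum_apply]
    have : ∀ k, (hatProd K x₀ (insert k S) x • vertexGrad K x₀ j k) (K m - x₀) =
        (if k = m then hatProd K x₀ (insert k S) x else 0) -
        (if j = m then K.coord k x₀ / K.coord j x₀ * hatProd K x₀ (insert k S) x else 0) := by
      intro k
      change hatProd K x₀ (insert k S) x * vertexGrad K x₀ j k (K m - x₀) = _
      rw [vertexGrad_vertex_sub hx₀]
      split_ifs <;> ring
    simp only [this, Finset.sum_sub_distrib, Finset.sum_ite_eq', Finset.mem_compl, ite_not]
    congr 1
    split_ifs <;> simp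
  rw [h, apexGrad_vertex_sub hx₀]
  ring

theorem fderiv_pow_mul_hatProd_of_notMem (hx₀ : x₀ ∈ interior (simplex K)) (p : ℕ)
    (S : Finset (Fin (d + 1))) {j : Fin (d + 1)} (hj : j ∉ S) {x : E d}
    (hx : x ∈ openSector K x₀ j) :
    fderiv ℝ (fun x => apexHat K x₀ x ^ p * hatProd K x₀ S x) x = 0 := by
  have : (fun x => apexHat K x₀ x ^ p * hatProd K x₀ S x) =ᶠ[nhds x] fun _ => 0 := by
    filter_upwards [(isOpen_openSector K x₀ j).mem_nhds hx] with y hy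
    rw [hatProd_eq_zero hx₀ hj hy, mul_zero]
  rw [this.fderiv_eq, fderiv_fun_const]
  rfl

end HatPolynomials

/-! ### Divergences of fields vanishing on the boundary -/

section Divergence

variable {d : ℕ} {K : AffineBasis (Fin (d + 1)) ℝ (E d)} {x₀ : E d} {G : ℝ}

/-- Up to a constant, the piecewise function that is `q j` on the `j`-th sector is the divergence
of a continuous piecewise polynomial field of degree at most `d` that vanishes on the boundary
of `K` and whose coefficients along the vectors from `x₀` to the vertices are bounded by `M` and
Lipschitz with constant `M * G`. -/
def IsDivModConst (K : AffineBasis (Fin (d + 1)) ℝ (E d)) (x₀ : E d) (G M : ℝ)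
    (q : Fin (d + 1) → E d → ℝ) : Prop :=
  ∃ (f : Fin (d + 1) → E d → ℝ) (c : ℝ), (∀ m, HatPoly K x₀ G d M (f m)) ∧
    (∀ m, ∀ x ∈ frontier (simplex K), f m x = 0) ∧
    ∀ j, ∀ x ∈ openSector K x₀ j, ∑ m, fderiv ℝ (f m) x (K m - x₀) = q j x - c

theorem IsDivModConst.mono (hG : 0 ≤ G) {M N : ℝ} {q : Fin (d + 1) → E d → ℝ}
    (h : IsDivModConst K x₀ G M q) (hMN : M ≤ N) : IsDivModConst K x₀ G N q :=
  let ⟨f, c, hf, hb, hq⟩ := h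
  ⟨f, c, fun m => (hf m).mono hG le_rfl hMN, hb, hq⟩

theorem IsDivModConst.congr {M : ℝ} {q r : Fin (d + 1) → E d → ℝ}
    (h : IsDivModConst K x₀ G M q) (hr : ∀ j, ∀ x ∈ openSector K x₀ j, r j x = q j x) :
    IsDivModConst K x₀ G M r :=
  let ⟨f, c, hf, hb, hq⟩ := h
  ⟨f, c, hf, hb, fun j x hx => by rw [hq j x hx, hr j x hx]⟩

theorem isDivModConst_const (hG : 0 ≤ G) (c : ℝ) : IsDivModConst K x₀ G 0 fun _ _ => c := by
  refine ⟨fun _ _ => 0, c, fun m => ?_, fun _ _ _ => rfl, fun j x _ => by simp⟩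
  exact (hatPoly_const hG 0).mono hG (Nat.zero_le d) (by simp)

theorem IsDivModConst.add {M N : ℝ} {q r : Fin (d + 1) → E d → ℝ}
    (hq : IsDivModConst K x₀ G M q) (hr : IsDivModConst K x₀ G N r) :
    IsDivModConst K x₀ G (M + N) fun j x => q j x + r j x := by
  obtain ⟨f, a, hf, hfb, hq⟩ := hq
  obtain ⟨g, b, hg, hgb, hr⟩ := hr
  refine ⟨fun m x => f m x + g m x, a + b, fun m => (hf m).add (hg m), fun m x hx => ?_,
    fun j x hx => ?_⟩
  · simp only [hfb m x hx, hgb m x hx, add_zero]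
  · have : ∀ m, fderiv ℝ (fun x => f m x + g m x) x (K m - x₀) =
        fderiv ℝ (f m) x (K m - x₀) + fderiv ℝ (g m) x (K m - x₀) := fun m => by
      rw [fderiv_fun_add ((hf m).diff j x hx) ((hg m).diff j x hx)]
      rfl
    simp only [this, Finset.sum_add_distrib, hq j x hx, hr j x hx]
    ring

theorem IsDivModConst.const_mul {M : ℝ} {q : Fin (d + 1) → E d → ℝ} (a : ℝ)
    (hq : IsDivModConst K x₀ G M q) :
    IsDivModConst K x₀ G (|a| * M) fun j x => a * q j x := by
  obtain ⟨f, c, hf, hb, hq⟩ := hq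
  refine ⟨fun m x => a * f m x, a * c, fun m => (hf m).const_mul a, fun m x hx => ?_,
    fun j x hx => ?_⟩
  · simp only [hb m x hx, mul_zero]
  · have : ∀ m, fderiv ℝ (fun x => a * f m x) x (K m - x₀) =
        a * fderiv ℝ (f m) x (K m - x₀) := fun m => by
      rw [fderiv_const_mul ((hf m).diff j x hx)]
      rfl
    simp only [this, ← Finset.mul_sum, hq j x hx]
    ring

theorem IsDivModConst.nonneg {M : ℝ} {q : Fin (d + 1) → E d → ℝ}
    (h : IsDivModConst K x₀ G M q) : 0 ≤ M :=
  let ⟨_, _, hf, _⟩ := h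
  (hf 0).nonneg

theorem IsDivModConst.const_mul_of_abs_le_one (hG : 0 ≤ G) {M : ℝ} {q : Fin (d + 1) → E d → ℝ}
    {a : ℝ} (hq : IsDivModConst K x₀ G M q) (ha : |a| ≤ 1) :
    IsDivModConst K x₀ G M fun j x => a * q j x :=
  (hq.const_mul a).mono hG (mul_le_of_le_one_left hq.nonneg ha)

theorem IsDivModConst.sum {ι : Type*} (hG : 0 ≤ G) {M : ℝ} (s : Finset ι)
    {q : ι → Fin (d + 1) → E d → ℝ} (hq : ∀ i ∈ s, IsDivModConst K x₀ G M (q i)) :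
    IsDivModConst K x₀ G (s.card * M) fun j x => ∑ i ∈ s, q i j x := by
  classical
  induction s using Finset.induction_on with
  | empty => simpa using isDivModConst_const (K := K) (x₀ := x₀) hG 0
  | insert a s ha ih =>
    simp only [Finset.sum_insert ha, Finset.card_insert_of_notMem ha]
    refine ((hq a (Finset.mem_insert_self a s)).add
      (ih fun i hi => hq i (Finset.mem_insert_of_mem hi))).mono hG ?_
    push_cast
    linarith

theorem isDivModConst_fderiv (hG : 0 ≤ G) {M : ℝ} {f : E d → ℝ} (hf : HatPoly K x₀ G d M f)
    (hb : ∀ x ∈ frontier (simplex K), f x = 0) (m : Fin (d + 1)) :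
    IsDivModConst K x₀ G M fun _ x => fderiv ℝ f x (K m - x₀) := by
  refine ⟨fun l x => (if l = m then 1 else 0) * f x, 0, fun l => ?_, fun l x hx => ?_,
    fun j x hx => ?_⟩
  · refine (hf.const_mul _).mono hG le_rfl (mul_le_of_le_one_left hf.nonneg ?_)
    split_ifs <;> simp
  · simp only [hb x hx, mul_zero]
  · have : ∀ l, fderiv ℝ (fun x => (if l = m then (1 : ℝ) else 0) * f x) x (K l - x₀) =
        if l = m then fderiv ℝ f x (K l - x₀) else 0 := fun l => by
      rw [fderiv_const_mul (hf.diff j x hx)]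
      split_ifs <;> simp
    simp only [this, Finset.sum_ite_eq', Finset.mem_univ, if_true, sub_zero]

/-- Radial fields: up to constants, `apexHat ^ k` is a divergence. -/
theorem isDivModConst_apexHat_pow (hx₀ : x₀ ∈ interior (simplex K)) (hG : GradBound K x₀ G)
    (k : ℕ) (hk : k < d) :
    IsDivModConst K x₀ G (k * 2 ^ (d + 1)) fun _ x => apexHat K x₀ x ^ k := by
  induction k with
  | zero => simpa using isDivModConst_const (K := K) (x₀ := x₀) hG.nonneg 1
  | succ k ih =>
    have hrad : IsDivModConst K x₀ G (2 ^ (d + 1)) fun _ x =>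
        (k + 1 + d) * apexHat K x₀ x ^ (k + 1) - (k + 1) * apexHat K x₀ x ^ k := by
      -- Since ∑ λₘ (Kₘ - x₀) = x - x₀, this is the radial field λ₀^(k+1) (x - x₀). Its divergence
      -- follows from Dλ₀(x - x₀) = λ₀ - 1.
      refine ⟨fun m x => apexHat K x₀ x ^ (k + 1) * vertexHat K x₀ m x, 0, fun m => ?_,
        fun m x hx => ?_, fun j x hx => ?_⟩
      · refine (((hatPoly_apexHat hx₀ hG).pow hG.nonneg (k + 1)).mul hG.nonneg
          (hatPoly_vertexHat hx₀ hG m)).mono hG.nonneg hk ?_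
        rw [mul_one, ← pow_succ']
        exact pow_le_pow_right₀ one_le_two (by omega)
      · simp [apexHat_eq_zero hx₀ hx]
      · have hd : ∀ m, fderiv ℝ (fun x => apexHat K x₀ x ^ (k + 1) * vertexHat K x₀ m x) x
            (K m - x₀) = apexHat K x₀ x ^ (k + 1) * (1 - if j = m then 1 else 0) +
            (k + 1) * apexHat K x₀ x ^ k * ((if j = m then vertexHat K x₀ m x *
              (K.coord j x₀)⁻¹ else 0) - vertexHat K x₀ m x) := by
          intro m
          have h := ((hasFDerivAt_apexHat hx).pow (k + 1)).mul (hasFDerivAt_vertexHat m hx)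
          refine (DFunLike.congr_fun h.fderiv (K m - x₀)).trans ?_
          change apexHat K x₀ x ^ (k + 1) * vertexGrad K x₀ j m (K m - x₀) +
            vertexHat K x₀ m x * (((k + 1) • apexHat K x₀ x ^ k) *
              apexGrad K x₀ j (K m - x₀)) = _
          rw [vertexGrad_vertex_sub hx₀, apexGrad_vertex_sub hx₀]
          have := (coord_pos K hx₀ j).ne'
          rw [if_pos rfl, nsmul_eq_mul]
          by_cases hjm : j = m
          · subst hjm
            simp only [if_true, div_self this]
            push_cast
            ring
          · simp only [if_neg hjm]
            push_cast
            ring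
        simp only [hd, Finset.sum_add_distrib, ← Finset.mul_sum, Finset.sum_sub_distrib,
          Finset.sum_ite_eq, Finset.mem_univ, if_true, sum_vertexHat,
          vertexHat_eq_zero hx₀ (openSector_subset_sector K x₀ j hx)]
        simp only [Finset.sum_const, Finset.card_univ, Fintype.card_fin, nsmul_eq_mul]
        push_cast
        ring
    have hpos : (0 : ℝ) < k + 1 + d := by positivity
    have h := (hrad.add ((ih (by omega)).const_mul (k + 1))).const_mul ((k + 1 + d : ℝ)⁻¹)
    refine (h.mono hG.nonneg ?_).congr fun j x _ => ?_
    · rw [abs_of_pos (inv_pos.2 hpos), abs_of_pos (by positivity : (0 : ℝ) < k + 1),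
        inv_mul_le_iff₀ hpos]
      push_cast
      have h2 : (0 : ℝ) < 2 ^ (d + 1) := by positivity
      have hd : (0 : ℝ) < d := by exact_mod_cast (by omega : 0 < d)
      have : (1 : ℝ) + (k + 1) * k ≤ (k + 1 + d) * (k + 1) := by
        nlinarith [mul_nonneg hd.le (Nat.cast_nonneg (α := ℝ) k), Nat.cast_nonneg (α := ℝ) k]
      nlinarith
    · field_simp
      ring

/-- The size of the coefficients constructed in `isDivModConst_indicator`. -/
def coeffBound (d : ℕ) : ℕ → ℝ
  | 0 => (d + 1) * 2 ^ (d + 1)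
  | n + 1 => 2 * 2 ^ (d + 1) + 2 * (d + 1) * coeffBound d n

theorem coeffBound_nonneg (d n : ℕ) : 0 ≤ coeffBound d n := by
  induction n with
  | zero => rw [coeffBound]; positivity
  | succ n ih => rw [coeffBound]; positivity

/-- Fields λ₀^(p+1) ∏_{l∉S} λₗ · (Kₘ - x₀) vanish on ∂K and have degree d when |S| = p + 2. Only the
direction Kᵢ - x₀ distinguishes cell i among the cells with index in S, through the 1/aᵢ in Dλ₀, and
that isolates the indicator of Kᵢ. The errors carry one vertex hat less and one more power of λ₀. -/
theorem isDivModConst_indicator (hd : 1 ≤ d) (hx₀ : x₀ ∈ interior (simplex K))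
    (hG : GradBound K x₀ G) (n : ℕ) : ∀ S : Finset (Fin (d + 1)), Sᶜ.card = n → 2 ≤ S.card →
      ∀ i ∈ S, IsDivModConst K x₀ G (coeffBound d n) fun j x =>
        if j = i then apexHat K x₀ x ^ (S.card - 2) * hatProd K x₀ S x else 0 := by
  have hcoef : ∀ (l : Fin (d + 1)) (p : ℕ), |K.coord l x₀ / (p + 1 : ℝ)| ≤ 1 := by
    intro l p
    have h0 := coord_pos K hx₀ l
    have h1 := coord_le_one K (interior_subset hx₀) l
    rw [abs_of_nonneg (by positivity), div_le_one (by positivity)]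
    linarith [Nat.cast_nonneg (α := ℝ) p]
  have hfield : ∀ (S : Finset (Fin (d + 1))) (p : ℕ), S.card = p + 2 → ∀ m,
      IsDivModConst K x₀ G (2 ^ (d + 1)) fun _ x =>
        fderiv ℝ (fun x => apexHat K x₀ x ^ (p + 1) * hatProd K x₀ S x) x (K m - x₀) := by
    intro S p hp m
    refine isDivModConst_fderiv hG.nonneg (hatPoly_pow_mul_hatProd hx₀ hG (p + 1) (by omega))
      (fun x hx => ?_) m
    rw [apexHat_eq_zero hx₀ hx, zero_pow (by omega), zero_mul]
  induction n with
  | zero =>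
    intro S hS _ i _
    obtain rfl : S = Finset.univ := by
      rwa [Finset.card_eq_zero, Finset.compl_eq_empty_iff] at hS
    obtain ⟨p, rfl⟩ : ∃ p, d = p + 1 := ⟨d - 1, by omega⟩
    have hp : (Finset.univ : Finset (Fin (p + 1 + 1))).card = p + 2 := by simp
    -- Here aᵢ/(p+1) · D(λ₀^(p+1))(Kᵢ - x₀) is λ₀^p on Kᵢ minus aᵢ λ₀^p everywhere; the second
    -- summand restores aᵢ λ₀^p.
    have h := ((hfield _ p hp i).const_mul_of_abs_le_one hG.nonneg (hcoef i p)).add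
      ((isDivModConst_apexHat_pow hx₀ hG p (by omega)).const_mul_of_abs_le_one hG.nonneg
        (by simpa using hcoef i 0))
    refine (h.mono hG.nonneg ?_).congr fun j x hx => ?_
    · rw [coeffBound]
      push_cast
      have : (0 : ℝ) < 2 ^ (p + 1 + 1) := by positivity
      nlinarith
    · have ha := (coord_pos K hx₀ j).ne'
      rw [fderiv_pow_mul_hatProd_apply hx₀ _ _ hx, hp]
      simp only [hatProd, Finset.compl_univ, Finset.sum_empty, Finset.prod_empty,
        Finset.mem_univ, if_true, Nat.add_sub_cancel]
      push_cast
      by_cases hji : j = i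
      · subst hji
        simp only [if_true]
        field_simp
        ring
      · simp only [if_neg hji]
        field_simp
        ring
  | succ n ih =>
    intro S hS h2 i hi
    obtain ⟨p, hp⟩ : ∃ p, S.card = p + 2 := ⟨S.card - 2, by omega⟩
    obtain ⟨m, hm⟩ : Sᶜ.Nonempty := Finset.card_pos.1 (by omega)
    rw [Finset.mem_compl] at hm
    have hins : ∀ l, l ∉ S → ∀ i' ∈ insert l S, IsDivModConst K x₀ G (coeffBound d n) fun j x =>
        if j = i' then apexHat K x₀ x ^ (p + 1) * hatProd K x₀ (insert l S) x else 0 := by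
      intro l hl i' hi'
      have hc : (insert l S).card = p + 3 := by rw [Finset.card_insert_of_notMem hl, hp]
      have := ih (insert l S) (by
        rw [Finset.compl_insert, Finset.card_erase_of_mem (Finset.mem_compl.2 hl), hS,
          Nat.add_sub_cancel]) (by omega) i' hi'
      rwa [hc] at this
    -- The weight aᵢ/(p+1) normalises the coefficient on Kᵢ to 1; the opposite weight in direction
    -- Kₘ - x₀ cancels the part common to all cells.
    have h1 := (hfield S p hp i).const_mul_of_abs_le_one hG.nonneg (hcoef i p)
    have h2' := (hfield S p hp m).const_mul_of_abs_le_one (a := -(K.coord i x₀ / (p + 1)))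
      hG.nonneg (by rw [abs_neg]; exact hcoef i p)
    have h3 := IsDivModConst.sum hG.nonneg Sᶜ fun l hl =>
      (hins l (Finset.mem_compl.1 hl) i (Finset.mem_insert_of_mem hi)).const_mul_of_abs_le_one
        hG.nonneg (hcoef l p)
    -- The derivative along Kₘ - x₀ leaves λ₀^(p+1) ∏_{l∉S∪{m}} λₗ on each cell with index in S. The
    -- index m is excluded from the sum, since the differentiated product vanishes identically on
    -- sector m.
    have h4 := IsDivModConst.sum hG.nonneg S fun i' hi' =>
      (hins m hm i' (Finset.mem_insert_of_mem hi')).const_mul_of_abs_le_one hG.nonneg (hcoef i p)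
    have hcard : ∀ T : Finset (Fin (d + 1)), (T.card : ℝ) ≤ d + 1 := fun T => by
      exact_mod_cast T.card_le_univ.trans_eq (Fintype.card_fin _)
    refine (((h1.add h2').add (h3.add h4)).mono hG.nonneg ?_).congr fun j x hx => ?_
    -- Two explicit fields contribute 2^(d+1) each, and each of the two sums has at most d + 1
    -- terms.
    · rw [coeffBound]
      have e1 := mul_le_mul_of_nonneg_right (hcard S) (coeffBound_nonneg d n)
      have e2 := mul_le_mul_of_nonneg_right (hcard Sᶜ) (coeffBound_nonneg d n)
      linarith
    · by_cases hj : j ∈ S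
      · have ha := (coord_pos K hx₀ j).ne'
        have hjm : j ≠ m := fun h => hm (h ▸ hj)
        rw [fderiv_pow_mul_hatProd_apply hx₀ _ _ hx, fderiv_pow_mul_hatProd_apply hx₀ _ _ hx, hp]
        simp only [hi, hm, hjm, if_true, if_false, Nat.add_sub_cancel, mul_ite, mul_zero,
          Finset.sum_ite_eq, hj]
        push_cast
        by_cases hji : j = i
        · subst hji
          simp only [if_true]
          have e1 : ∑ k ∈ Sᶜ, K.coord k x₀ / K.coord j x₀ * hatProd K x₀ (insert k S) x =
              (K.coord j x₀)⁻¹ * ∑ k ∈ Sᶜ, K.coord k x₀ * hatProd K x₀ (insert k S) x := by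
            rw [Finset.mul_sum]
            exact Finset.sum_congr rfl fun k _ => by ring
          have e2 : ∑ k ∈ Sᶜ, K.coord k x₀ / (p + 1 : ℝ) *
              (apexHat K x₀ x ^ (p + 1) * hatProd K x₀ (insert k S) x) =
              apexHat K x₀ x ^ (p + 1) / (p + 1) *
                ∑ k ∈ Sᶜ, K.coord k x₀ * hatProd K x₀ (insert k S) x := by
            rw [Finset.mul_sum]
            exact Finset.sum_congr rfl fun k _ => by ring
          rw [e1, e2]
          field_simp
          ring
        · simp only [if_neg hji, Finset.sum_const_zero]
          ring
      · have hji : j ≠ i := fun h => hj (h ▸ hi)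
        rw [fderiv_pow_mul_hatProd_of_notMem hx₀ _ _ hj hx]
        simp [hji, hj]

end Divergence

/-! ### Shape regularity bounds the gradients of the hat functions -/

section ShapeRegularity

variable {d : ℕ} {K : AffineBasis (Fin (d + 1)) ℝ (E d)} {x₀ : E d}

/-- On sector j the hat functions are convex weights: x = λ₀ x₀ + ∑_{k≠j} λₖ Kₖ. -/
theorem sector_inter_simplex_subset_cell (hx₀ : x₀ ∈ interior (simplex K)) (j : Fin (d + 1)) :
    simplex K ∩ sector K x₀ j ⊆ cell K x₀ j := by
  rintro x ⟨hxK, hxj⟩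
  have h0 := vertexHat_eq_zero hx₀ hxj
  have hw : ∀ k, (if k = j then apexHat K x₀ x else vertexHat K x₀ k x) =
      vertexHat K x₀ k x + if k = j then apexHat K x₀ x else 0 := by
    intro k
    split_ifs with h
    · rw [h, h0, zero_add]
    · rw [add_zero]
  have hmem := (convex_convexHull ℝ (insert x₀ (K '' {j}ᶜ))).sum_mem (t := Finset.univ)
    (w := fun k => if k = j then apexHat K x₀ x else vertexHat K x₀ k x)
    (z := fun k => if k = j then x₀ else K k) (fun k _ => ?_) ?_ (fun k _ => ?_)
  · suffices hx : ∑ k, (if k = j then apexHat K x₀ x else vertexHat K x₀ k x) •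
        (if k = j then x₀ else K k) = x by
      rw [hx] at hmem
      exact hmem
    have : ∀ k, (if k = j then apexHat K x₀ x else vertexHat K x₀ k x) •
        (if k = j then x₀ else K k) =
        vertexHat K x₀ k x • K k + if k = j then apexHat K x₀ x • x₀ else 0 := by
      intro k
      split_ifs with h
      · rw [h, h0, zero_smul, zero_add]
      · rw [add_zero]
    rw [Finset.sum_congr rfl fun k _ => this k, Finset.sum_add_distrib, Finset.sum_ite_eq',
      if_pos (Finset.mem_univ j)]
    simp only [vertexHat, sub_smul, Finset.sum_sub_distrib, sum_coord_smul]
    have e : ∀ k, (K.coord k x₀ * apexHat K x₀ x) • K k =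
        apexHat K x₀ x • (K.coord k x₀ • K k) := fun k => by rw [smul_smul, mul_comm]
    simp only [e, ← Finset.smul_sum, sum_coord_smul, sub_add_cancel]
  · split_ifs
    exacts [apexHat_nonneg hx₀ hxK, vertexHat_nonneg hx₀ k x]
  · simp only [hw, Finset.sum_add_distrib, sum_vertexHat, Finset.sum_ite_eq', Finset.mem_univ,
      if_true, sub_add_cancel]
  · refine subset_convexHull ℝ _ ?_
    split_ifs with h
    exacts [mem_insert _ _, mem_insert_of_mem _ (mem_image_of_mem K h)]

theorem exists_closedBall_subset_cell (hx₀ : x₀ ∈ interior (simplex K)) (j : Fin (d + 1)) :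
    ∃ c r, 0 < r ∧ Metric.closedBall c r ⊆ cell K x₀ j := by
  have hpos := coord_pos K hx₀
  -- Moving from x₀ away from Kⱼ enters sector j. With this step length μⱼ = aⱼ² > 0 and μₖ = aₖ (1
  -- + aⱼ) for k ≠ j, so the point stays inside K.
  set x := x₀ + K.coord j x₀ • (x₀ - K j)
  have hc : ∀ k, K.coord k x = K.coord k x₀ +
      K.coord j x₀ * (K.coord k x₀ - if k = j then 1 else 0) := fun k => by
    rw [coord_add, map_smul, dcoord_sub, K.coord_apply, smul_eq_mul]
  have hx : x ∈ interior (simplex K) ∩ openSector K x₀ j := by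
    constructor
    · rw [interior_simplex_eq]
      intro k
      rw [hc]
      split_ifs with h
      · rw [h]
        nlinarith [hpos j]
      · nlinarith [hpos j, hpos k, mul_pos (hpos j) (hpos k)]
    · intro k hk
      rw [hc, hc, if_pos rfl, if_neg hk, div_lt_div_iff₀ (hpos j) (hpos k)]
      nlinarith [hpos j, hpos k, mul_pos (hpos j) (hpos k)]
  obtain ⟨r, hr, hb⟩ := Metric.nhds_basis_closedBall.mem_iff.1
    ((isOpen_interior.inter (isOpen_openSector K x₀ j)).mem_nhds hx)
  exact ⟨x, r, hr, hb.trans ((inter_subset_inter interior_subset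
    (openSector_subset_sector K x₀ j)).trans (sector_inter_simplex_subset_cell hx₀ j))⟩

/-- A linear functional that varies by at most `1` on a set varies slowly if the set contains a
large ball. -/
theorem two_mul_abs_le_of_closedBall_subset {T : Set (E d)} {ℓ : E d →L[ℝ] ℝ}
    (hℓ : ∀ x ∈ T, ∀ y ∈ T, |ℓ (x - y)| ≤ 1) {c : E d} {r : ℝ} (hr : 0 ≤ r)
    (hb : Metric.closedBall c r ⊆ T) (w : E d) : 2 * r * |ℓ w| ≤ ‖w‖ := by
  rcases eq_or_ne w 0 with rfl | hw
  · simp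
  have hw' : 0 < ‖w‖ := norm_pos_iff.2 hw
  have hn : ‖(r / ‖w‖) • w‖ = r := by
    rw [norm_smul, Real.norm_of_nonneg (by positivity), div_mul_cancel₀ _ hw'.ne']
  -- The functional is compared at the two ends of the diameter parallel to w.
  have h := hℓ (c + (r / ‖w‖) • w) (hb (by simp [hn])) (c - (r / ‖w‖) • w) (hb (by simp [hn]))
  rw [show c + (r / ‖w‖) • w - (c - (r / ‖w‖) • w) = (2 * r / ‖w‖) • w by
    rw [mul_div_assoc, mul_smul, two_smul]; abel, map_smul, smul_eq_mul, abs_mul,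
    abs_of_nonneg (by positivity), div_mul_eq_mul_div, div_le_one hw'] at h
  exact h

theorem inscribedDiam_mul_abs_le {T : Set (E d)} (hT : T.Nonempty) {ℓ : E d →L[ℝ] ℝ}
    (hℓ : ∀ x ∈ T, ∀ y ∈ T, |ℓ (x - y)| ≤ 1) (w : E d) : inscribedDiam T * |ℓ w| ≤ ‖w‖ := by
  rcases (abs_nonneg (ℓ w)).eq_or_lt with h | h
  · rw [← h, mul_zero]
    exact norm_nonneg w
  rw [← le_div_iff₀ h]
  obtain ⟨c, hc⟩ := hT
  -- A ball of radius 0 shows that the set of diameters is nonempty.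
  refine csSup_le ⟨0, c, 0, le_rfl, by simpa using hc, by simp⟩ ?_
  rintro _ ⟨c, r, hr, hb, rfl⟩
  rw [le_div_iff₀ h]
  exact two_mul_abs_le_of_closedBall_subset hℓ hr hb w

theorem abs_sub_le_one {a b : ℝ} (ha : 0 ≤ a) (ha' : a ≤ 1) (hb : 0 ≤ b) (hb' : b ≤ 1) :
    |a - b| ≤ 1 :=
  abs_le.2 ⟨by linarith, by linarith⟩

theorem abs_apexGrad_sub_le_one (hx₀ : x₀ ∈ interior (simplex K)) (j : Fin (d + 1)) :
    ∀ x ∈ cell K x₀ j, ∀ y ∈ cell K x₀ j, |apexGrad K x₀ j (x - y)| ≤ 1 := by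
  intro x hx y hy
  obtain ⟨hx, hxj⟩ := cell_subset hx₀ j hx
  obtain ⟨hy, hyj⟩ := cell_subset hx₀ j hy
  have : apexGrad K x₀ j (x - y) = apexHat K x₀ x - apexHat K x₀ y := by
    rw [apexHat_eq K x₀ hxj, apexHat_eq K x₀ hyj, apexGrad_apply, dcoord_sub]
    ring
  rw [this]
  exact abs_sub_le_one (apexHat_nonneg hx₀ hx) (apexHat_le_one hx₀ x) (apexHat_nonneg hx₀ hy)
    (apexHat_le_one hx₀ y)

theorem abs_vertexGrad_sub_le_one (hx₀ : x₀ ∈ interior (simplex K)) (j k : Fin (d + 1)) :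
    ∀ x ∈ cell K x₀ j, ∀ y ∈ cell K x₀ j, |vertexGrad K x₀ j k (x - y)| ≤ 1 := by
  intro x hx y hy
  obtain ⟨hx, hxj⟩ := cell_subset hx₀ j hx
  obtain ⟨hy, hyj⟩ := cell_subset hx₀ j hy
  have : vertexGrad K x₀ j k (x - y) = vertexHat K x₀ k x - vertexHat K x₀ k y := by
    rw [vertexHat, vertexHat, apexHat_eq K x₀ hxj, apexHat_eq K x₀ hyj, vertexGrad_apply,
      apexGrad_apply, dcoord_sub, dcoord_sub]
    ring
  rw [this]
  exact abs_sub_le_one (vertexHat_nonneg hx₀ k x) (vertexHat_le_one hx₀ hx k)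
    (vertexHat_nonneg hx₀ k y) (vertexHat_le_one hx₀ hy k)

theorem apex_mem_cell (j : Fin (d + 1)) : x₀ ∈ cell K x₀ j :=
  subset_convexHull ℝ _ (mem_insert _ _)

theorem vertex_mem_cell {j k : Fin (d + 1)} (h : k ≠ j) : K k ∈ cell K x₀ j :=
  subset_convexHull ℝ _ (mem_insert_of_mem _ (mem_image_of_mem K h))

theorem isBounded_cell (j : Fin (d + 1)) : Bornology.IsBounded (cell K x₀ j) :=
  isBounded_convexHull.2 (((toFinite _).image K).insert x₀).isBounded

/-- The inscribed ball is not larger than an edge at `x₀`. -/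
theorem inscribedDiam_le_edge (hx₀ : x₀ ∈ interior (simplex K)) {j m : Fin (d + 1)}
    (h : m ≠ j) : inscribedDiam (cell K x₀ j) ≤ ‖K m - x₀‖ := by
  have := inscribedDiam_mul_abs_le ⟨x₀, apex_mem_cell j⟩ (abs_apexGrad_sub_le_one hx₀ j) (K m - x₀)
  rwa [apexGrad_vertex_sub hx₀, if_neg h.symm, zero_sub, abs_neg, abs_one, mul_one] at this

/-- Besides a ball in the cell, this needs an upper bound on the inscribed diameters, as the real
supremum of an unbounded set is 0. An edge at x₀, along which the functional `apexGrad` changes by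
1, gives it. -/
theorem inscribedDiam_pos (hd : 1 ≤ d) (hx₀ : x₀ ∈ interior (simplex K)) (j : Fin (d + 1)) :
    0 < inscribedDiam (cell K x₀ j) := by
  obtain ⟨c, r, hr, hb⟩ := exists_closedBall_subset_cell hx₀ j
  have : Nontrivial (Fin (d + 1)) := Fin.nontrivial_iff_two_le.2 (by omega)
  obtain ⟨m, hm⟩ := exists_ne j
  refine (by linarith : 0 < 2 * r).trans_le (le_csSup ⟨‖K m - x₀‖, ?_⟩ ⟨c, r, hr.le, hb, rfl⟩)
  rintro _ ⟨c, r, hr, hb, rfl⟩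
  have := two_mul_abs_le_of_closedBall_subset (abs_apexGrad_sub_le_one hx₀ j) hr hb (K m - x₀)
  rwa [apexGrad_vertex_sub hx₀, if_neg hm.symm, zero_sub, abs_neg, abs_one, mul_one] at this

theorem diam_cell_le (hd : 1 ≤ d) (hx₀ : x₀ ∈ interior (simplex K)) {σ : ℝ}
    (hσ : refinementShapeConst K x₀ ≤ σ) (j : Fin (d + 1)) :
    Metric.diam (cell K x₀ j) ≤ σ * inscribedDiam (cell K x₀ j) := by
  have h : shapeConst (cell K x₀ j) ≤ σ :=
    (Finset.le_sup' (fun i => shapeConst (cell K x₀ i)) (Finset.mem_univ j)).trans hσ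
  rwa [shapeConst, div_le_iff₀ (inscribedDiam_pos hd hx₀ j)] at h

theorem exists_ne_and_ne (hd : 2 ≤ d) (k l : Fin (d + 1)) : ∃ j, j ≠ k ∧ j ≠ l := by
  have : ({k, l} : Finset (Fin (d + 1))).card < (Finset.univ : Finset (Fin (d + 1))).card := by
    rw [Finset.card_univ, Fintype.card_fin]
    exact Finset.card_le_two.trans_lt (by omega)
  obtain ⟨j, -, hj⟩ := Finset.exists_mem_notMem_of_card_lt_card this
  exact ⟨j, by simpa [not_or] using hj⟩

/-- All cells have inscribed balls of a size comparable to the diameter of `K`. -/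
theorem diam_simplex_le (hd : 2 ≤ d) (hx₀ : x₀ ∈ interior (simplex K)) {σ : ℝ}
    (hσ : refinementShapeConst K x₀ ≤ σ) (j : Fin (d + 1)) :
    Metric.diam (simplex K) ≤ σ ^ 2 * inscribedDiam (cell K x₀ j) := by
  have hdiam := diam_cell_le (by omega) hx₀ hσ
  have hρ := inscribedDiam_pos (by omega : 1 ≤ d) hx₀
  have hσ0 : 0 ≤ σ := by
    by_contra! h
    nlinarith [hdiam j, hρ j, Metric.diam_nonneg (s := cell K x₀ j), mul_neg_of_neg_of_pos h (hρ j)]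
  rw [simplex, convexHull_diam]
  refine Metric.diam_le_of_forall_dist_le (mul_nonneg (sq_nonneg σ) (hρ j).le) ?_
  rintro _ ⟨k, rfl⟩ _ ⟨l, rfl⟩
  -- Cell j' contains the edge from Kₖ to Kₗ; cells j and j' share the edge from x₀ to Kₘ, which
  -- compares their sizes. Both choices require d ≥ 2.
  obtain ⟨j', hk, hl⟩ := exists_ne_and_ne hd k l
  obtain ⟨m, hm, hm'⟩ := exists_ne_and_ne hd j j'
  have h1 := Metric.dist_le_diam_of_mem (isBounded_cell (K := K) (x₀ := x₀) j') (vertex_mem_cell hk.symm)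
    (vertex_mem_cell hl.symm)
  have h2 := inscribedDiam_le_edge hx₀ hm'
  have h3 := Metric.dist_le_diam_of_mem (isBounded_cell j) (vertex_mem_cell hm)
    (apex_mem_cell (K := K) (x₀ := x₀) j)
  rw [dist_eq_norm] at h3
  calc dist (K k) (K l) ≤ σ * inscribedDiam (cell K x₀ j') := h1.trans (hdiam j')
    _ ≤ σ * (σ * inscribedDiam (cell K x₀ j)) :=
        mul_le_mul_of_nonneg_left (h2.trans (h3.trans (hdiam j))) hσ0
    _ = σ ^ 2 * inscribedDiam (cell K x₀ j) := by ring

theorem norm_sub_le_diam_simplex {x y : E d} (hx : x ∈ simplex K) (hy : y ∈ simplex K) :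
    ‖x - y‖ ≤ Metric.diam (simplex K) := by
  rw [← dist_eq_norm]
  exact Metric.dist_le_diam_of_mem (isCompact_simplex K).isBounded hx hy

theorem diam_simplex_pos (hd : 1 ≤ d) (K : AffineBasis (Fin (d + 1)) ℝ (E d)) :
    0 < Metric.diam (simplex K) := by
  have : Nontrivial (Fin (d + 1)) := Fin.nontrivial_iff_two_le.2 (by omega)
  obtain ⟨m, hm⟩ := exists_ne (0 : Fin (d + 1))
  refine lt_of_lt_of_le ?_ (norm_sub_le_diam_simplex (subset_convexHull ℝ _ (mem_range_self m))
    (subset_convexHull ℝ _ (mem_range_self 0)))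
  exact norm_pos_iff.2 (sub_ne_zero.2 (K.ind.injective.ne hm))

/-- A hat function takes values in [0, 1] on a cell and is affine there, so its gradient is at most
the inverse of the inscribed diameter, hence at most σ²/h. -/
theorem gradBound_of_refinementShapeConst_le (hd : 2 ≤ d) (hx₀ : x₀ ∈ interior (simplex K)) {σ : ℝ}
    (hσ : refinementShapeConst K x₀ ≤ σ) :
    GradBound K x₀ (σ ^ 2 / Metric.diam (simplex K)) := by
  have hpos := diam_simplex_pos (by omega) K
  have key : ∀ (j : Fin (d + 1)) (ℓ : E d →L[ℝ] ℝ),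
      (∀ x ∈ cell K x₀ j, ∀ y ∈ cell K x₀ j, |ℓ (x - y)| ≤ 1) →
      ∀ w, |ℓ w| ≤ σ ^ 2 / Metric.diam (simplex K) * ‖w‖ := by
    intro j ℓ hℓ w
    rw [div_mul_eq_mul_div, le_div_iff₀ hpos]
    have h1 := mul_le_mul_of_nonneg_left (diam_simplex_le hd hx₀ hσ j) (abs_nonneg (ℓ w))
    have h2 := mul_le_mul_of_nonneg_left
      (inscribedDiam_mul_abs_le ⟨x₀, apex_mem_cell j⟩ hℓ w) (sq_nonneg σ)
    linarith
  exact ⟨by positivity, fun j => key j _ (abs_apexGrad_sub_le_one hx₀ j),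
    fun j k => key j _ (abs_vertexGrad_sub_le_one hx₀ j k)⟩

end ShapeRegularity

/-! ### The `H¹` norm of a face bubble -/

section Bubble

variable {d : ℕ} {K : AffineBasis (Fin (d + 1)) ℝ (E d)}

theorem apply_eq_sum_single (A : E d →L[ℝ] ℝ) (w : E d) :
    A w = ∑ l, A (EuclideanSpace.single l 1) * w l := by
  have hw : w = ∑ l, w l • EuclideanSpace.single l (1 : ℝ) := by
    ext k
    simp [Pi.single_apply]
  conv_lhs => rw [hw]
  simp only [map_sum, map_smul, smul_eq_mul, mul_comm]

theorem hasFDerivAt_scalarBubble (i : Fin (d + 1)) (x : E d) :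
    HasFDerivAt (scalarBubble K i) (∑ m ∈ Finset.univ.erase i,
      (∏ l ∈ (Finset.univ.erase i).erase m, K.coord l x) • dcoord K m) x :=
  HasFDerivAt.finsetProd (u := Finset.univ.erase i) fun m _ => hasFDerivAt_coord K m x

theorem contDiff_scalarBubble (i : Fin (d + 1)) : ContDiff ℝ 1 (scalarBubble K i) := by
  have h : ∀ k, ContDiff ℝ 1 (K.coord k) := fun k => by
    have : (K.coord k : E d → ℝ) = fun y => K.coord k 0 + dcoord K k y := by
      ext y
      simpa using coord_add K k 0 y
    rw [this]
    exact contDiff_const.add (dcoord K k).contDiff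
  exact contDiff_prod fun k _ => h k

theorem exists_lipschitzOnWith_scalarBubble_mul (i : Fin (d + 1)) (a : ℝ) :
    ∃ C, LipschitzOnWith C (fun x => scalarBubble K i x * a) (simplex K) :=
  (((contDiff_scalarBubble i).mul contDiff_const).locallyLipschitz.locallyLipschitzOn
    ).exists_lipschitzOnWith_of_compact (isCompact_simplex K)

theorem scalarBubble_nonneg (i : Fin (d + 1)) {x : E d} (hx : x ∈ simplex K) :
    0 ≤ scalarBubble K i x := by
  rw [simplex_eq] at hx
  exact Finset.prod_nonneg fun k _ => hx k

/-- Along Kₖ - Kᵢ with k ≠ i only the factor μₖ of Bᵢ changes, at unit rate, because μᵢ is absent.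
So the derivative is Bᵢ with μₖ ≤ 1 removed, which is at least Bᵢ, while the direction has length at
most h. -/
theorem sq_scalarBubble_le (hd : 1 ≤ d) (i : Fin (d + 1)) {x : E d} (hx : x ∈ simplex K) :
    scalarBubble K i x ^ 2 ≤ Metric.diam (simplex K) ^ 2 *
      ∑ l, (fderiv ℝ (scalarBubble K i) x (EuclideanSpace.single l 1)) ^ 2 := by
  have : Nontrivial (Fin (d + 1)) := Fin.nontrivial_iff_two_le.2 (by omega)
  obtain ⟨k, hk⟩ := exists_ne i
  set w := K k - K i
  have hki : k ∈ Finset.univ.erase i := Finset.mem_erase.2 ⟨hk, Finset.mem_univ k⟩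
  have hder : fderiv ℝ (scalarBubble K i) x w =
      ∏ l ∈ (Finset.univ.erase i).erase k, K.coord l x := by
    rw [(hasFDerivAt_scalarBubble i x).fderiv, sum_apply, Finset.sum_eq_single k]
    · change _ * dcoord K k (K k - K i) = _
      rw [dcoord_sub, K.coord_apply_eq, K.coord_apply_ne hk, sub_zero, mul_one]
    · intro m hm hmk
      change _ * dcoord K m (K k - K i) = _
      rw [dcoord_sub, K.coord_apply_ne hmk, K.coord_apply_ne (Finset.ne_of_mem_erase hm), sub_self,
        mul_zero]
    · exact fun h => absurd hki h
  have hle : scalarBubble K i x ≤ fderiv ℝ (scalarBubble K i) x w := by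
    rw [hder, scalarBubble, ← Finset.mul_prod_erase _ _ hki]
    refine mul_le_of_le_one_left (Finset.prod_nonneg fun l _ => ?_) (coord_le_one K hx k)
    rw [simplex_eq] at hx
    exact hx l
  have hw : ‖w‖ ^ 2 ≤ Metric.diam (simplex K) ^ 2 :=
    pow_le_pow_left₀ (norm_nonneg _) (norm_sub_le_diam_simplex
      (subset_convexHull ℝ _ (mem_range_self k)) (subset_convexHull ℝ _ (mem_range_self i))) 2
  calc scalarBubble K i x ^ 2 ≤ (fderiv ℝ (scalarBubble K i) x w) ^ 2 :=
        pow_le_pow_left₀ (scalarBubble_nonneg i hx) hle 2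
    _ ≤ (∑ l, (fderiv ℝ (scalarBubble K i) x (EuclideanSpace.single l 1)) ^ 2) *
          ∑ l, w l ^ 2 := by
        rw [apply_eq_sum_single]
        exact Finset.sum_mul_sq_le_sq_mul_sq _ _ _
    _ ≤ _ := by
        rw [← EuclideanSpace.real_norm_sq_eq, mul_comm]
        exact mul_le_mul_of_nonneg_right hw (Finset.sum_nonneg fun l _ => sq_nonneg _)

theorem volume_interior_simplex_lt_top : volume (interior (simplex K)) < ⊤ :=
  ((isCompact_simplex K).isBounded.subset interior_subset).measure_lt_top

/-- The mean square of a face bubble is bounded below by this constant. -/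
def bubbleMeanSq (d : ℕ) : ℝ := (1 / 2) ^ d * ((1 / (2 * (d + 1))) ^ d) ^ 2

theorem bubbleMeanSq_pos (d : ℕ) : 0 < bubbleMeanSq d := by
  rw [bubbleMeanSq]
  positivity

theorem integrableOn_sq_scalarBubble (i : Fin (d + 1)) :
    IntegrableOn (fun x => scalarBubble K i x ^ 2) (interior (simplex K)) :=
  ((((contDiff_scalarBubble i).continuous.pow 2).continuousOn).integrableOn_compact
    (isCompact_simplex K)).mono_set interior_subset

/-- Shrinking K by 1/2 towards its centroid keeps a fraction 2^(-d) of the volume, and there every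
μₖ exceeds 1/(2(d+1)). -/
theorem le_integral_sq_scalarBubble (i : Fin (d + 1)) :
    bubbleMeanSq d * volume.real (interior (simplex K)) ≤
      ∫ x in interior (simplex K), scalarBubble K i x ^ 2 := by
  set U := interior (simplex K)
  set b : E d := Finset.univ.centroid ℝ K
  set ε : ℝ := 1 / (2 * (d + 1))
  have hε : 0 < ε := by positivity
  have hb : ∀ k, K.coord k b = 1 / (d + 1) := fun k => by
    rw [K.coord_apply_centroid (Finset.mem_univ k)]
    simp
  set V : Set (E d) := {x | ∀ k, ε < K.coord k x}
  have hV : IsOpen V := by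
    have : V = ⋂ k, {x | ε < K.coord k x} := by
      ext x
      simp [V]
    rw [this]
    exact isOpen_iInter_of_finite fun k => isOpen_lt continuous_const (continuous_coord K k)
  have hVU : V ⊆ U := by
    intro x hx
    rw [show U = _ from interior_simplex_eq K]
    exact fun k => hε.trans (hx k)
  have himg : AffineMap.homothety b (1 / 2 : ℝ) '' U ⊆ V := by
    rintro _ ⟨x, hx, rfl⟩ k
    rw [show U = _ from interior_simplex_eq K] at hx
    rw [AffineMap.homothety_apply, vsub_eq_sub, vadd_eq_add, add_comm _ b, coord_add, map_smul,
      dcoord_sub, hb, smul_eq_mul]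
    have h1 : ε = 1 / 2 * (1 / (d + 1)) := by
      simp only [ε]
      field_simp
    have := hx k
    rw [h1]
    linarith
  have hvol : (1 / 2 : ℝ) ^ d * volume.real U ≤ volume.real V := by
    have hfin : volume V ≠ ⊤ := ((measure_mono hVU).trans_lt volume_interior_simplex_lt_top).ne
    refine le_trans (le_of_eq ?_) (measureReal_mono himg hfin)
    rw [measureReal_def, measureReal_def, Measure.addHaar_image_homothety, ENNReal.toReal_mul,
      finrank_euclideanSpace_fin, abs_of_pos (by positivity),
      ENNReal.toReal_ofReal (by positivity)]
  have hlow : ∀ x ∈ V, (ε ^ d) ^ 2 ≤ scalarBubble K i x ^ 2 := by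
    intro x hx
    refine pow_le_pow_left₀ (by positivity) ?_ 2
    have : ε ^ d = ∏ _k ∈ Finset.univ.erase i, ε := by
      rw [Finset.prod_const, Finset.card_erase_of_mem (Finset.mem_univ i), Finset.card_univ,
        Fintype.card_fin, Nat.add_sub_cancel]
    rw [this]
    exact Finset.prod_le_prod (fun _ _ => hε.le) fun k _ => (hx k).le
  calc bubbleMeanSq d * volume.real U = (1 / 2 : ℝ) ^ d * volume.real U * (ε ^ d) ^ 2 := by
        rw [bubbleMeanSq]
        ring
    _ ≤ volume.real V * (ε ^ d) ^ 2 := mul_le_mul_of_nonneg_right hvol (sq_nonneg _)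
    _ ≤ ∫ x in V, scalarBubble K i x ^ 2 := by
        rw [← smul_eq_mul]
        exact setIntegral_ge_of_const_le hV.measurableSet
          ((measure_mono hVU).trans_lt volume_interior_simplex_lt_top).ne hlow
          ((integrableOn_sq_scalarBubble i).mono_set hVU)
    _ ≤ ∫ x in U, scalarBubble K i x ^ 2 :=
        setIntegral_mono_set (integrableOn_sq_scalarBubble i)
          (Filter.Eventually.of_forall fun x => sq_nonneg _) hVU.eventuallyLE

theorem lineDeriv_faceBubble (i : Fin (d + 1)) (n : E d) (x : E d) (l j : Fin d) :
    lineDeriv ℝ (fun y => faceBubble K i n y l) x (EuclideanSpace.single j 1) =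
      fderiv ℝ (scalarBubble K i) x (EuclideanSpace.single j 1) * n l := by
  have hB : HasFDerivAt (scalarBubble K i) (fderiv ℝ (scalarBubble K i) x) x :=
    ((contDiff_scalarBubble i).differentiable one_ne_zero x).hasFDerivAt
  have h : HasFDerivAt (fun y => faceBubble K i n y l) (n l • fderiv ℝ (scalarBubble K i) x) x :=
    hB.mul_const (n l)
  rw [h.differentiableAt.lineDeriv_eq_fderiv, h.fderiv]
  exact mul_comm _ _

theorem weakPartial_faceBubble (i : Fin (d + 1)) (n : E d) (l j : Fin d) :
    weakPartial (interior (simplex K)) j (fun y => faceBubble K i n y l)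
      =ᵐ[volume.restrict (interior (simplex K))]
      fun x => fderiv ℝ (scalarBubble K i) x (EuclideanSpace.single j 1) * n l := by
  obtain ⟨C, hC⟩ := exists_lipschitzOnWith_scalarBubble_mul (K := K) i (n l)
  filter_upwards [weakPartial_ae_eq isOpen_interior interior_subset hC j] with x hx
  rw [← lineDeriv_faceBubble]
  exact hx

/-- The summand 1/h² comes from bounding the gradient below pointwise by Bᵢ/h. Keeping both summands
makes the final estimate uniform in h although the full norm is not scale invariant. -/
theorem le_h1Norm_faceBubble (hd : 1 ≤ d) (i : Fin (d + 1)) {n : E d} (hn : ‖n‖ = 1) :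
    Real.sqrt (bubbleMeanSq d * volume.real (interior (simplex K)) *
      (1 + 1 / Metric.diam (simplex K) ^ 2)) ≤
      h1Norm (interior (simplex K)) (faceBubble K i n) := by
  set U := interior (simplex K)
  have hU : MeasurableSet U := isOpen_interior.measurableSet
  set I := ∫ x in U, scalarBubble K i x ^ 2
  have hn2 : ∑ l, n l ^ 2 = 1 := by rw [← EuclideanSpace.real_norm_sq_eq, hn, one_pow]
  have h0 : ∑ l, ∫ x in U, (faceBubble K i n x l) ^ 2 = I := by
    have : ∀ l, ∫ x in U, (faceBubble K i n x l) ^ 2 = n l ^ 2 * I := fun l => by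
      rw [← integral_const_mul]
      refine integral_congr_ae (Filter.Eventually.of_forall fun x => ?_)
      change (scalarBubble K i x * n l) ^ 2 = n l ^ 2 * scalarBubble K i x ^ 2
      ring
    simp only [this, ← Finset.sum_mul, hn2, one_mul]
  have hint : ∀ j, IntegrableOn (fun x =>
      (fderiv ℝ (scalarBubble K i) x (EuclideanSpace.single j 1)) ^ 2) U := by
    intro j
    have hc : Continuous fun x =>
        (fderiv ℝ (scalarBubble K i) x (EuclideanSpace.single j 1)) ^ 2 :=
      (((contDiff_scalarBubble i).continuous_fderiv one_ne_zero).clm_apply continuous_const).pow 2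
    exact (hc.continuousOn.integrableOn_compact (isCompact_simplex K)).mono_set interior_subset
  have h1 : ∑ l, ∑ j, ∫ x in U, (weakPartial U j (fun y => faceBubble K i n y l) x) ^ 2 =
      ∫ x in U, ∑ j, (fderiv ℝ (scalarBubble K i) x (EuclideanSpace.single j 1)) ^ 2 := by
    have : ∀ l j, ∫ x in U, (weakPartial U j (fun y => faceBubble K i n y l) x) ^ 2 =
        n l ^ 2 * ∫ x in U, (fderiv ℝ (scalarBubble K i) x (EuclideanSpace.single j 1)) ^ 2 := by
      intro l j
      rw [← integral_const_mul]
      refine integral_congr_ae ?_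
      filter_upwards [weakPartial_faceBubble (K := K) i n l j] with x hx
      rw [hx]
      ring
    simp only [this, ← Finset.mul_sum, ← Finset.sum_mul, hn2, one_mul]
    rw [integral_finsetSum _ fun j _ => hint j]
  have hpos := diam_simplex_pos hd K
  have h2 : 1 / Metric.diam (simplex K) ^ 2 * I ≤
      ∫ x in U, ∑ j, (fderiv ℝ (scalarBubble K i) x (EuclideanSpace.single j 1)) ^ 2 := by
    rw [← integral_const_mul]
    refine setIntegral_mono_on ((integrableOn_sq_scalarBubble i).const_mul _)
      (integrable_finsetSum _ fun j _ => hint j) hU fun x hx => ?_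
    rw [one_div, inv_mul_le_iff₀ (by positivity)]
    exact sq_scalarBubble_le hd i (interior_subset hx)
  rw [h1Norm]
  refine Real.sqrt_le_sqrt ?_
  rw [h0, h1]
  have h3 := mul_le_mul_of_nonneg_right (le_integral_sq_scalarBubble (K := K) i)
    (by positivity : 0 ≤ 1 + 1 / Metric.diam (simplex K) ^ 2)
  linarith

/-- An upper bound for the `H¹` norm of a Lipschitz field. -/
theorem h1Norm_le {v : E d → E d} {M : ℝ} {C : NNReal}
    (hM : ∀ l, ∀ x ∈ simplex K, |v x l| ≤ M)
    (hC : ∀ l, LipschitzOnWith C (fun x => v x l) (simplex K)) :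
    h1Norm (interior (simplex K)) v ≤
      Real.sqrt ((d * M ^ 2 + d * (d * (C : ℝ) ^ 2)) * volume.real (interior (simplex K))) := by
  set U := interior (simplex K)
  have h0 : ∀ l, ∫ x in U, (v x l) ^ 2 ≤ M ^ 2 * volume.real U := by
    intro l
    refine (Real.le_norm_self _).trans (norm_setIntegral_le_of_norm_le_const
      volume_interior_simplex_lt_top fun x hx => ?_)
    rw [norm_pow]
    exact pow_le_pow_left₀ (norm_nonneg _) (hM l x (interior_subset hx)) 2
  have h1 : ∀ l j, ∫ x in U, (weakPartial U j (fun y => v y l) x) ^ 2 ≤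
      (C : ℝ) ^ 2 * volume.real U := by
    intro l j
    refine (Real.le_norm_self _).trans (norm_setIntegral_le_of_norm_le_const_ae
      volume_interior_simplex_lt_top ?_)
    filter_upwards [weakPartial_ae_eq isOpen_interior interior_subset (hC l) j,
      ae_restrict_mem isOpen_interior.measurableSet] with x hx hxU
    rw [norm_pow, hx]
    exact pow_le_pow_left₀ (norm_nonneg _)
      (norm_lineDeriv_single_le isOpen_interior interior_subset (hC l) j hxU) 2
  rw [h1Norm]
  refine Real.sqrt_le_sqrt ?_
  have e0 := Finset.sum_le_sum fun l (_ : l ∈ Finset.univ) => h0 l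
  have e1 := Finset.sum_le_sum fun l (_ : l ∈ Finset.univ) =>
    Finset.sum_le_sum fun j (_ : j ∈ Finset.univ) => h1 l j
  simp only [Finset.sum_const, Finset.card_univ, Fintype.card_fin, nsmul_eq_mul] at e0 e1
  linarith

end Bubble

/-! ### The modified face bubbles -/

section Modified

variable {d : ℕ} {K : AffineBasis (Fin (d + 1)) ℝ (E d)} {x₀ : E d} {G : ℝ}

theorem HatPoly.lipschitzOnWith {k : ℕ} {M : ℝ} {f : E d → ℝ} (hG : 0 ≤ G)
    (hf : HatPoly K x₀ G k M f) :
    LipschitzOnWith ⟨M * G, mul_nonneg hf.nonneg hG⟩ f (simplex K) :=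
  LipschitzOnWith.of_dist_le_mul fun x hx y hy => by
    rw [Real.dist_eq, dist_eq_norm]
    exact hf.lip x hx y hy

theorem memPc_of_hatPoly (hG : 0 ≤ G) {M : ℝ} {v : E d → E d}
    (hv : ∀ l, HatPoly K x₀ G d M fun x => v x l) : MemPc d K x₀ v where
  continuousOn := by
    have h : ContinuousOn (fun x => (WithLp.ofLp (v x) : Fin d → ℝ)) (simplex K) :=
      continuousOn_pi.2 fun l => ((hv l).lipschitzOnWith hG).continuousOn
    exact (PiLp.continuous_toLp 2 fun _ : Fin d => ℝ).comp_continuousOn h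
  isPolyOn i l := (hv l).poly i
  memH1 l := memH1_of_lipschitzOnWith isOpen_interior interior_subset
    (isCompact_simplex K).isBounded ((hv l).lipschitzOnWith hG)

theorem memPc_faceBubble (i : Fin (d + 1)) (n : E d) : MemPc d K x₀ (faceBubble K i n) where
  continuousOn := ((contDiff_scalarBubble i).continuous.smul continuous_const).continuousOn
  isPolyOn j l := by
    have h : ∀ s : Finset (Fin (d + 1)), IsPolyOn s.card (cell K x₀ j)
        fun x => ∏ k ∈ s, K.coord k x := by
      intro s
      induction s using Finset.induction_on with
      | empty => simpa using IsPolyOn.const (1 : ℝ)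
      | insert a s ha ih =>
        simp only [Finset.prod_insert ha, Finset.card_insert_of_notMem ha]
        rw [add_comm]
        exact (isPolyOn_coord K a _).mul ih
    have h1 := (h (Finset.univ.erase i)).const_mul (n l)
    rw [Finset.card_erase_of_mem (Finset.mem_univ i), Finset.card_univ, Fintype.card_fin,
      Nat.add_sub_cancel] at h1
    exact h1.congr fun x _ => mul_comm _ _
  memH1 l := by
    obtain ⟨C, hC⟩ := exists_lipschitzOnWith_scalarBubble_mul (K := K) i (n l)
    exact memH1_of_lipschitzOnWith isOpen_interior interior_subset
      (isCompact_simplex K).isBounded hC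

theorem weakDiv_faceBubble_of_one {K : AffineBasis (Fin (1 + 1)) ℝ (E 1)} (i : Fin (1 + 1))
    (n : E 1) : ∃ c : ℝ, ∀ᵐ x ∂(volume.restrict (interior (simplex K))),
      weakDiv (interior (simplex K)) (faceBubble K i n) x = c := by
  obtain ⟨k, hk⟩ := exists_ne i
  have he : Finset.univ.erase i = {k} := by
    ext m
    simp only [Finset.mem_erase, Finset.mem_univ, and_true, Finset.mem_singleton]
    omega
  refine ⟨∑ l, dcoord K k (EuclideanSpace.single l 1) * n l, ?_⟩
  filter_upwards [ae_all_iff.2 fun l => weakPartial_faceBubble (K := K) i n l l] with x hx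
  refine Finset.sum_congr rfl fun l _ => ?_
  rw [hx l, (hasFDerivAt_scalarBubble i x).fderiv, he]
  simp

/-- The weak divergence of a field with piecewise polynomial components. -/
theorem weakDiv_ae_eq (hx₀ : x₀ ∈ interior (simplex K)) (hG : 0 ≤ G) {M : ℝ} {v : E d → E d}
    (hv : ∀ l, HatPoly K x₀ G d M fun x => v x l) {c : ℝ}
    (hc : ∀ j, ∀ x ∈ openSector K x₀ j,
      ∑ l, fderiv ℝ (fun y => v y l) x (EuclideanSpace.single l 1) = c) :
    ∀ᵐ x ∂(volume.restrict (interior (simplex K))),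
      weakDiv (interior (simplex K)) v x = c := by
  have h := ae_all_iff.2 fun l => weakPartial_ae_eq isOpen_interior interior_subset
    ((hv l).lipschitzOnWith hG) l
  filter_upwards [h, ae_restrict_of_ae (ae_exists_mem_openSector hx₀)] with x hx ⟨j, hj⟩
  rw [← hc j x hj]
  refine Finset.sum_congr rfl fun l _ => ?_
  rw [hx l, ((hv l).diff j x hj).lineDeriv_eq_fderiv]

/-- The divergence of the bubble of the `i`-th cell in direction `n`, up to a constant. -/
theorem isDivModConst_hatProd_singleton (hd : 1 ≤ d) (hx₀ : x₀ ∈ interior (simplex K))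
    (hG : GradBound K x₀ G) (i : Fin (d + 1)) {n : E d} (hn : ‖n‖ = 1) :
    IsDivModConst K x₀ G ((d + 1) * (G * coeffBound d (d - 1)))
      fun _ x => fderiv ℝ (fun x => apexHat K x₀ x ^ 0 * hatProd K x₀ {i} x) x n := by
  have hcard : ({i}ᶜ : Finset (Fin (d + 1))).card = d := by simp [Finset.card_compl]
  -- By the product rule ∂ₙP is, on cell i, a combination over k ≠ i of the functions for S = {i,
  -- k}, whose power of λ₀ is 0; the coefficients ∂ₙλₖ are constant there and at most G.
  have h := IsDivModConst.sum (M := G * coeffBound d (d - 1)) hG.nonneg ({i}ᶜ : Finset _)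
    (q := fun k j x => vertexGrad K x₀ i k n *
      if j = i then apexHat K x₀ x ^ 0 * hatProd K x₀ (insert k {i}) x else 0) fun k hk => by
      have hki : k ∉ ({i} : Finset (Fin (d + 1))) := Finset.mem_compl.1 hk
      have hc : (insert k {i} : Finset (Fin (d + 1))).card = 2 := by
        rw [Finset.card_insert_of_notMem hki, Finset.card_singleton]
      have h1 := isDivModConst_indicator hd hx₀ hG (d - 1) (insert k {i})
        (by rw [Finset.card_compl, hc, Fintype.card_fin]; omega) hc.ge i (by simp)
      rw [hc] at h1
      refine (h1.const_mul (vertexGrad K x₀ i k n)).mono hG.nonneg ?_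
      refine mul_le_mul_of_nonneg_right ?_ (coeffBound_nonneg _ _)
      simpa [hn] using hG.vertex i k n
  refine (h.mono hG.nonneg ?_).congr fun j x hx => ?_
  · rw [hcard]
    refine mul_le_mul_of_nonneg_right (by linarith) (mul_nonneg hG.nonneg (coeffBound_nonneg _ _))
  · by_cases hji : j = i
    · subst hji
      rw [(hasFDerivAt_pow_mul_hatProd 0 {j} hx).fderiv]
      simp only [pow_zero, one_smul, CharP.cast_eq_zero, zero_mul, zero_smul, smul_zero, add_zero,
        sum_apply, if_true, one_mul]
      exact Finset.sum_congr rfl fun k _ => mul_comm _ _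
    · rw [fderiv_pow_mul_hatProd_of_notMem hx₀ 0 {i} (by simpa using hji) hx]
      simp [hji]

/-- The bound for the components of the modified face bubbles. -/
def componentBound (d : ℕ) (σ : ℝ) : ℝ :=
  2 ^ (d + 1) + (d + 1) * ((d + 1) * (σ ^ 2 * coeffBound d (d - 1)))

/-- The field is β = P n - ∑ fₘ (Kₘ - x₀), where the sum vanishes on ∂K and has divergence div(P n)
- c; so div β = c. -/
theorem exists_modified_faceBubble (hd : 1 ≤ d) (hx₀ : x₀ ∈ interior (simplex K)) {σ : ℝ}
    (hG : GradBound K x₀ (σ ^ 2 / Metric.diam (simplex K))) (i : Fin (d + 1)) {n : E d}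
    (hn : ‖n‖ = 1) :
    ∃ β : E d → E d,
      (∀ l, HatPoly K x₀ (σ ^ 2 / Metric.diam (simplex K)) d (componentBound d σ)
        fun x => β x l) ∧
      (∀ x ∈ frontier (simplex K), β x = faceBubble K i n x) ∧
      ∃ c : ℝ, ∀ᵐ x ∂(volume.restrict (interior (simplex K))),
        weakDiv (interior (simplex K)) β x = c := by
  obtain ⟨f, c, hf, hfb, hdiv⟩ := isDivModConst_hatProd_singleton hd hx₀ hG i hn
  set G := σ ^ 2 / Metric.diam (simplex K)
  set P : E d → ℝ := fun x => apexHat K x₀ x ^ 0 * hatProd K x₀ {i} x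
  have hpos := diam_simplex_pos hd K
  have hP : HatPoly K x₀ G d (2 ^ (d + 1)) P := hatPoly_pow_mul_hatProd hx₀ hG 0 (by simp)
  set β : E d → E d := fun x => P x • n - ∑ m, f m x • (K m - x₀)
  have hβ : ∀ l, (fun x => β x l) =
      fun x => n l * P x + ∑ m, -((K m - x₀) l) * f m x := by
    intro l
    ext x
    simp only [β, PiLp.sub_apply, PiLp.smul_apply, smul_eq_mul, WithLp.ofLp_sum, Finset.sum_apply,
      neg_mul, Finset.sum_neg_distrib, mul_comm (n l), mul_comm ((K _) l - x₀ l)]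
    ring
  have hpoly : ∀ l, HatPoly K x₀ G d (componentBound d σ) fun x => β x l := by
    intro l
    rw [hβ l]
    have hle : ∀ m, |-((K m - x₀) l)| ≤ Metric.diam (simplex K) := fun m => by
      rw [abs_neg]
      exact (PiLp.norm_apply_le (K m - x₀) l).trans (norm_sub_le_diam_simplex
        (subset_convexHull ℝ _ (mem_range_self m)) (interior_subset hx₀))
    have hsum := HatPoly.sum hG.nonneg Finset.univ fun m _ =>
      ((hf m).const_mul (-((K m - x₀) l))).mono hG.nonneg le_rfl
        (mul_le_mul_of_nonneg_right (hle m) (hf m).nonneg)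
    refine ((hP.const_mul (n l)).add hsum).mono hG.nonneg le_rfl ?_
    -- The edge vectors contribute a factor h, which cancels the 1/h in G; the bound depends only on
    -- d and σ.
    rw [Finset.sum_const, Finset.card_univ, Fintype.card_fin, nsmul_eq_mul, componentBound]
    refine add_le_add (mul_le_of_le_one_left (by positivity) ?_) (le_of_eq ?_)
    · rw [← hn]
      exact PiLp.norm_apply_le n l
    · simp only [G]
      push_cast
      field_simp
  refine ⟨β, hpoly, fun x hx => ?_, c, weakDiv_ae_eq hx₀ hG.nonneg hpoly fun j x hx => ?_⟩
  · have h1 : P x = scalarBubble K i x := by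
      simp only [P, pow_zero, one_mul, hatProd, scalarBubble, vertexHat, apexHat_eq_zero hx₀ hx,
        mul_zero, sub_zero]
      congr 1
      ext k
      simp
    simp only [β, h1, hfb _ x hx, zero_smul, Finset.sum_const_zero, sub_zero]
    rfl
  · have hder : ∀ l, fderiv ℝ (fun y => β y l) x (EuclideanSpace.single l 1) =
        fderiv ℝ P x (EuclideanSpace.single l 1) * n l -
          ∑ m, fderiv ℝ (f m) x (EuclideanSpace.single l 1) * (K m - x₀) l := by
      intro l
      have h : HasFDerivAt (fun y => n l * P y + ∑ m, -((K m - x₀) l) * f m y)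
          (n l • fderiv ℝ P x + ∑ m, -((K m - x₀) l) • fderiv ℝ (f m) x) x :=
        ((hP.diff j x hx).hasFDerivAt.const_mul (n l)).add
          (HasFDerivAt.fun_sum fun m _ => ((hf m).diff j x hx).hasFDerivAt.const_mul _)
      rw [hβ l, h.fderiv]
      change n l * fderiv ℝ P x _ + (∑ m, -((K m - x₀) l) • fderiv ℝ (f m) x) _ = _
      rw [sum_apply, sub_eq_add_neg, ← Finset.sum_neg_distrib, mul_comm]
      congr 1
      refine Finset.sum_congr rfl fun m _ => ?_
      change -((K m - x₀) l) * fderiv ℝ (f m) x _ = _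
      ring
    simp only [hder, Finset.sum_sub_distrib]
    rw [Finset.sum_comm, ← apply_eq_sum_single]
    simp only [← apply_eq_sum_single]
    rw [hdiv j x hx, sub_sub_cancel]

/-- The constant of the `H¹` stability estimate. -/
def stabilityConst (d : ℕ) (σ : ℝ) : ℝ :=
  Real.sqrt ((d * componentBound d σ ^ 2 + d * (d * (componentBound d σ * σ ^ 2) ^ 2)) /
    bubbleMeanSq d) + 1

/-- Both norms are compared with |K|: the squared norm of β is at most a multiple of (1 + 1/h²)|K|,
and that of the bubble is at least `bubbleMeanSq d` (1 + 1/h²)|K|. -/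
theorem h1Norm_le_stabilityConst_mul (hd : 1 ≤ d) {σ : ℝ} {β : E d → E d} {i : Fin (d + 1)}
    {n : E d} (hn : ‖n‖ = 1) (hG : 0 ≤ σ ^ 2 / Metric.diam (simplex K))
    (hβ : ∀ l, HatPoly K x₀ (σ ^ 2 / Metric.diam (simplex K)) d (componentBound d σ)
      fun x => β x l) :
    h1Norm (interior (simplex K)) β ≤
      stabilityConst d σ * h1Norm (interior (simplex K)) (faceBubble K i n) := by
  set h := Metric.diam (simplex K)
  set M := componentBound d σ
  set V := volume.real (interior (simplex K))
  have hpos : 0 < h := diam_simplex_pos hd K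
  have hκ := bubbleMeanSq_pos d
  have hV : 0 ≤ V := measureReal_nonneg
  have hM : 0 ≤ M := (hβ ⟨0, hd⟩).nonneg
  have hup := h1Norm_le (C := ⟨M * (σ ^ 2 / h), mul_nonneg hM hG⟩) (fun l x hx => (hβ l).abs_le x hx) fun l => (hβ l).lipschitzOnWith hG
  have hlow := le_h1Norm_faceBubble (K := K) hd i hn
  have hA : 0 ≤ d * M ^ 2 + d * (d * (M * σ ^ 2) ^ 2) := by positivity
  refine hup.trans ?_
  have h1 : Real.sqrt ((d * M ^ 2 + d * (d * (M * (σ ^ 2 / h)) ^ 2)) * V) ≤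
      Real.sqrt ((d * M ^ 2 + d * (d * (M * σ ^ 2) ^ 2)) / bubbleMeanSq d) *
        Real.sqrt (bubbleMeanSq d * V * (1 + 1 / h ^ 2)) := by
    rw [← Real.sqrt_mul (by positivity)]
    refine Real.sqrt_le_sqrt ?_
    have e : (d * M ^ 2 + d * (d * (M * σ ^ 2) ^ 2)) / bubbleMeanSq d *
        (bubbleMeanSq d * V * (1 + 1 / h ^ 2)) =
        (d * M ^ 2 + d * (d * (M * (σ ^ 2 / h)) ^ 2)) * V +
          (d * (d * (M * σ ^ 2) ^ 2) + d * M ^ 2 / h ^ 2) * V := by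
      field_simp
      ring
    rw [e]
    exact le_add_of_nonneg_right (by positivity)
  refine h1.trans ?_
  rw [stabilityConst]
  exact mul_le_mul (by linarith) hlow (Real.sqrt_nonneg _) (by positivity)

end Modified

end

end MacroBubble

theorem proposition4p2 (d : ℕ) (hd : 1 ≤ d) (σ : ℝ) :
    ∃ C : ℝ, 0 < C ∧
      ∀ (K : AffineBasis (Fin (d + 1)) ℝ (MacroBubble.E d)) (x₀ : MacroBubble.E d),
        x₀ ∈ interior (MacroBubble.simplex K) →
        MacroBubble.refinementShapeConst K x₀ ≤ σ →
        ∀ (i : Fin (d + 1)) (n : MacroBubble.E d), MacroBubble.IsOutwardUnitNormal K i n →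
          ∃ β : MacroBubble.E d → MacroBubble.E d,
            MacroBubble.MemPc d K x₀ β ∧
            (∀ x ∈ frontier (MacroBubble.simplex K), β x = MacroBubble.faceBubble K i n x) ∧
            (∃ c : ℝ, ∀ᵐ x ∂(MeasureTheory.volume.restrict (interior (MacroBubble.simplex K))),
              MacroBubble.weakDiv (interior (MacroBubble.simplex K)) β x = c) ∧
            MacroBubble.h1Norm (interior (MacroBubble.simplex K)) β ≤
              C * MacroBubble.h1Norm (interior (MacroBubble.simplex K))
                (MacroBubble.faceBubble K i n) := by
  open MacroBubble in
  -- The summand 1 in the constant gives positivity and covers d = 1, where β is the bubble itself.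
  have hC : 1 ≤ stabilityConst d σ := le_add_of_nonneg_left (Real.sqrt_nonneg _)
  refine ⟨stabilityConst d σ, by linarith, fun K x₀ hx₀ hσ i n hn => ?_⟩
  rcases hd.eq_or_lt with rfl | hd2
  · exact ⟨faceBubble K i n, memPc_faceBubble i n, fun _ _ => rfl, weakDiv_faceBubble_of_one i n,
      le_mul_of_one_le_left (Real.sqrt_nonneg _) hC⟩
  · have hG := gradBound_of_refinementShapeConst_le hd2 hx₀ hσ
    obtain ⟨β, hβ, hb, hc⟩ := exists_modified_faceBubble hd hx₀ hG i hn.norm_eq_one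
    exact ⟨β, memPc_of_hatPoly hG.nonneg hβ, hb, hc,
      h1Norm_le_stabilityConst_mul hd hn.norm_eq_one hG.nonneg hβ⟩
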